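/- **Setting.** Let $\Omega\subset\mathbb R^2$ be a bounded open set, let $(\cdot,\cdot)$ and $\|\cdot\|$ be the inner product and norm of $L^2(\Omega)$ (for vector- or matrix-valued functions), and let $V=\{v\in H^1_0(\Omega)^2:\nabla\cdot v=0\}$. Let $\lambda_1$ be the smallest eigenvalue of the Stokes operator $A:V\to V'$, $\langle Au,v\rangle=(\nabla u,\nabla v)$; that is, the smallest $\lambda$ for which some $0\ne w\in V$ satisfies $(\nabla w,\nabla v)=\lambda(w,v)$ for all $v\in V$. Let $b(u,v,w)=((u\cdot\nabla)v,w)$. Let $\nu>0$, $\Delta t>0$, $t_n=n\Delta t$, $\theta\in(0,1)$, and $$\alpha_2=\tfrac{\theta+1}{2},\ \alpha_1=-\theta,\ \alpha_0=\tfrac{\theta-1}{2},\qquad \beta_2=\tfrac{2+\theta-\theta^2}{4},\ \beta_1=\tfrac{\theta^2}{2},\ \beta_0=\tfrac{2-\theta-\theta^2}{4}.$$ For a sequence $(z_n)$ put $z_{n,\beta}=\sum_{\ell=0}^2\beta_\ell z_{n-1+\ell}$. Let $f\in L^\infty(\mathbb R_+;L^2(\Omega)^2)$ with norm $\|f\|_\infty$,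 represented by a function with $\|f(t)\|\le\|f\|_\infty$ for every $t\ge0$. A sequence $(u_n)_{n\ge0}\subset V$ is a DLN velocity if for all $n\ge1$ and all $v\in V$ $$\frac1{\Delta t}\Big(\sum_{\ell=0}^2\alpha_\ell u_{n-1+\ell},v\Big)+\nu(\nabla u_{n,\beta},\nabla v)+b(u_{n,\beta},u_{n,\beta},v)=(f(t_{n,\beta}),v).$$ Put $$\|(u,v)\|_{G}^2=\tfrac{1+\theta}{4}\|u\|^2+\tfrac{1-\theta}{4}\|v\|^2,\qquad \|(u,v)\|_{H}^2=h_{11}\|u\|^2+h_{22}\|v\|^2,$$ $a_1=-\sqrt{\theta(1-\theta^2)/2}$, $a_0=a_2=-a_1/2$, and $\underline h(\theta)=\frac{\theta^3}{2}\big[1-\frac12\theta(1-\theta)\big]$. **Theorem.** There are constants $C_h(\theta),C_\epsilon(\theta)>0$, depending only on $\theta\in(0,1)$, such that the following holds for all such $\Omega,\nu$ and all $\Delta t>0$ with $$\Delta t<\frac1{\nu\lambda_1}\min\Big\{\frac{8\theta(1-\theta^2)}{8-6\theta^2+3\theta^4},\,2(1-\theta)\Big\}.$$ There exist $\epsilon>0$,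 $a,b,c\in\mathbb R$ and $h_{11},h_{22}$ (independent of $f$ and $(u_n)$) with $$h_{11}>\underline h(\theta)>0,\quad h_{22}>\tfrac1{16}\theta(1-\theta)^2(1+\theta)(2+\theta)>0,\quad \max\{h_{11},h_{22}\}<C_h(\theta),\quad \tfrac14<\tfrac1\epsilon<\frac{C_\epsilon(\theta)}{\nu\lambda_1\Delta t},$$ such that for all $x,y,z\in L^2(\Omega)^2$ $$\|(x,y)\|_G^2-\|(y,z)\|_G^2+\|a_2x+a_1y+a_0z\|^2+\tfrac{\nu\Delta t\lambda_1}{2}\|\beta_2x+\beta_1y+\beta_0z\|^2=(1+\epsilon)\|(x,y)\|_H^2-\|(y,z)\|_H^2+\|ax+by+cz\|^2,$$ and such that, for every $f$ and every DLN velocity $(u_n)$ as above, with $$K_1=C_h(\theta)\big(\|u_1\|^2+\|u_0\|^2\big)+\frac{C_\epsilon(\theta)}{2\nu^2\lambda_1^2}\|f\|_\infty^2,\qquad K_2=\big(K_1/\underline h(\theta)\big)^{1/2},$$ the following estimates hold. 1. For all $N\ge2$: $\displaystyle \|(u_N,u_{N-1})\|_H^2\le\frac1{(1+\epsilon)^{N-1}}\|(u_1,u_0)\|_H^2+\frac{C_\epsilon(\theta)}{2\nu^2\lambda_1^2}\|f\|_\infty^2.$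 2. For all $N\ge2$: $\|u_N\|\le K_2$. 3. For all $N\ge1$ and $1\le i\le N-1$: $\displaystyle \nu\Delta t\sum_{n=i}^{N-1}\|\nabla u_{n,\beta}\|^2\le2\|(u_i,u_{i-1})\|_G^2+\frac{(N-i)\Delta t}{\nu\lambda_1}\|f\|_\infty^2.$ 4. For all $N\ge1$ and $1\le i\le N-1$: $$\begin{aligned}&\Delta t\,\frac{\nu(2\beta_2-1)}8\sum_{j=i}^{N-1}\|\nabla u_{j+1}\|^2+\|(u_N,u_{N-1})\|_G^2+\Delta t\,\nu\Big[\tfrac14\|\nabla u_N\|^2+\Big(\tfrac{\beta_0}2+\tfrac{2\beta_2-1}8\Big)\|\nabla u_{N-1}\|^2\Big]\\&+\sum_{j=i}^{N-1}\Big(\tfrac\theta2\|u_{j+1}-u_j\|^2+\tfrac{1-\theta}4\|u_{j+1}-u_{j-1}\|^2\Big)+\nu\Delta t\sum_{j=i}^{N-1}\Big(\tfrac{\beta_1}2\|\nabla u_{j+1}+\nabla u_j\|^2+\tfrac{\beta_0}2\|\nabla u_{j+1}+\nabla u_{j-1}\|^2\Big)\\&\le\Big(1+\frac{K_2^4(\beta_0^2+\beta_1^2)^2}{\nu^4(2\beta_2-1)^3}\Big)\|(u_i,u_{i-1})\|_G^2+\Delta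 t\,\nu\Big[\tfrac14\|\nabla u_i\|^2+\Big(\tfrac{\beta_0}2+\tfrac{2\beta_2-1}8\Big)\|\nabla u_{i-1}\|^2\Big]\\&\quad+\frac{(N-i)\Delta t}{\nu(2\beta_2-1)\lambda_1}\Big(2+\frac{K_2^4(\beta_0^2+\beta_1^2)^2}{2\nu^4(2\beta_2-1)^2}\Big)\|f\|_\infty^2.\end{aligned}$$ -/

import Mathlib

open MeasureTheory Set
open scoped ContDiff

noncomputable section

namespace DLN

/-! ## Function spaces on a planar open set -/

/-- The plane `ℝ²` with its Euclidean norm. -/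
abbrev Plane : Type := EuclideanSpace ℝ (Fin 2)

/-- Values of velocity gradients: the `i`-th entry is the vector `∂u/∂xᵢ`; the norm is the
Euclidean (Frobenius) one. -/
abbrev GradVal : Type := PiLp 2 (fun _ : Fin 2 => Plane)

/-- `L²(Ω)²`, with `⟪u, v⟫ = ∫_Ω u · v dx`. -/
abbrev L2 (Ω : Set Plane) : Type := Lp Plane 2 (volume.restrict Ω)

/-- Square integrable gradient fields, with `⟪g, h⟫ = ∫_Ω ∑ᵢ gᵢ · hᵢ dx`. -/
abbrev L2Grad (Ω : Set Plane) : Type := Lp GradVal 2 (volume.restrict Ω)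

/-- The classical gradient `(∂φ/∂x₁, ∂φ/∂x₂)` of a vector field `φ`. -/
def classicalGrad (φ : Plane → Plane) (x : Plane) : GradVal :=
  WithLp.toLp 2 (fun i => fderiv ℝ φ x (EuclideanSpace.single i 1))

/-- The pairs `(φ, ∇φ)` with `φ ∈ C_c^∞(Ω)²`, as classes of square integrable functions. -/
def testGraph (Ω : Set Plane) : Submodule ℝ (L2 Ω × L2Grad Ω) where
  carrier := {p | ∃ φ : Plane → Plane, ContDiff ℝ ∞ φ ∧ HasCompactSupport φ ∧ tsupport φ ⊆ Ω ∧
    p.1 =ᵐ[volume.restrict Ω] φ ∧ p.2 =ᵐ[volume.restrict Ω] classicalGrad φ}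
  zero_mem' := by
    refine ⟨0, contDiff_const, HasCompactSupport.zero, by simp [tsupport], ?_, ?_⟩
    · exact Lp.coeFn_zero _ _ _
    · filter_upwards [Lp.coeFn_zero GradVal 2 (volume.restrict Ω)] with x hx
      rw [Prod.snd_zero, hx]
      ext i
      simp [classicalGrad]
  add_mem' := by
    rintro p q ⟨φ, hφ, hφc, hφs, hp1, hp2⟩ ⟨ψ, hψ, hψc, hψs, hq1, hq2⟩
    refine ⟨φ + ψ, hφ.add hψ, hφc.add hψc,
      (tsupport_add φ ψ).trans (union_subset hφs hψs), ?_, ?_⟩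
    · exact (Lp.coeFn_add _ _).trans (hp1.add hq1)
    · filter_upwards [Lp.coeFn_add p.2 q.2, hp2, hq2] with x hx h1 h2
      have h3 := hφ.differentiable (by simp) x
      have h4 := hψ.differentiable (by simp) x
      rw [Prod.snd_add, hx, Pi.add_apply, h1, h2]
      ext i
      simp [classicalGrad, fderiv_add h3 h4]
  smul_mem' := by
    rintro c p ⟨φ, hφ, hφc, hφs, hp1, hp2⟩
    refine ⟨c • φ, contDiff_const.smul hφ, hφc.smul_left (f := fun _ => c),
      (tsupport_smul_subset_right (fun _ => c) φ).trans hφs, ?_, ?_⟩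
    · exact (Lp.coeFn_smul _ _).trans (hp1.const_smul c)
    · filter_upwards [Lp.coeFn_smul c p.2, hp2] with x hx h1
      have h3 := hφ.differentiable (by simp) x
      rw [Prod.smul_snd, hx, Pi.smul_apply, h1]
      ext i
      simp [classicalGrad, fderiv_const_smul h3]

/-- `H₀¹(Ω)²`, the closure of `C_c^∞(Ω)²` in the `H¹`-norm. A function `u` is carried together with
its weak gradient, as the pair `(u, ∇u)`; the second component is determined by the first. -/
def H10 (Ω : Set Plane) : Submodule ℝ (L2 Ω × L2Grad Ω) := (testGraph Ω).topologicalClosure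

/-- The pairs `(u, g)` for which the trace of `g` vanishes, that is `∇ · u = 0` if `g = ∇u`. -/
def divFree (Ω : Set Plane) : Submodule ℝ (L2 Ω × L2Grad Ω) where
  carrier := {p | ∀ᵐ x ∂(volume.restrict Ω), ∑ i, (p.2 x i) i = 0}
  zero_mem' := by
    change ∀ᵐ x ∂(volume.restrict Ω), _
    filter_upwards [Lp.coeFn_zero GradVal 2 (volume.restrict Ω)] with x hx
    rw [Prod.snd_zero, hx]
    simp
  add_mem' := by
    intro p q hp hq
    change ∀ᵐ x ∂(volume.restrict Ω), _
    filter_upwards [Lp.coeFn_add p.2 q.2, hp, hq] with x hx h1 h2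
    rw [Prod.snd_add, hx]
    simp only [Pi.add_apply, PiLp.add_apply, Finset.sum_add_distrib, h1, h2, add_zero]
  smul_mem' := by
    intro c p hp
    change ∀ᵐ x ∂(volume.restrict Ω), _
    filter_upwards [Lp.coeFn_smul c p.2, hp] with x hx h1
    rw [Prod.smul_snd, hx]
    simp only [Pi.smul_apply, PiLp.smul_apply, smul_eq_mul, ← Finset.mul_sum, h1, mul_zero]

/-- `V = {v ∈ H₀¹(Ω)² : ∇ · v = 0}`. -/
def V (Ω : Set Plane) : Submodule ℝ (L2 Ω × L2Grad Ω) := H10 Ω ⊓ divFree Ω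

/-- An element of `V` as an element of `L²(Ω)²`. -/
def vel {Ω : Set Plane} (u : V Ω) : L2 Ω := u.1.1

/-- The weak gradient `∇u` of an element of `V`. -/
def grad {Ω : Set Plane} (u : V Ω) : L2Grad Ω := u.1.2

/-- `b(u, v, w) = ((u · ∇)v, w) = ∫_Ω ∑ᵢ uᵢ (∂v/∂xᵢ) · w dx`. -/
def trilinear {Ω : Set Plane} (u v w : V Ω) : ℝ :=
  ∫ x in Ω, ∑ i, (vel u x) i * inner ℝ (grad v x i) (vel w x)

/-- `lam` is an eigenvalue of the Stokes operator `A : V → V'`, `⟨Au, v⟩ = (∇u, ∇v)`. -/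
def IsStokesEigenvalue (Ω : Set Plane) (lam : ℝ) : Prop :=
  ∃ w : V Ω, vel w ≠ 0 ∧ ∀ v : V Ω, inner ℝ (grad w) (grad v) = lam * inner ℝ (vel w) (vel v)

/-- The smallest eigenvalue `λ₁` of the Stokes operator. -/
def stokesLambda (Ω : Set Plane) : ℝ := sInf {lam | IsStokesEigenvalue Ω lam}

/-! ## The force -/

/-- `‖f‖_∞ = ‖f‖_{L^∞(ℝ₊; L²(Ω)²)}`, an essential supremum over `t ≥ 0`. -/
def forceNorm {Ω : Set Plane} (f : ℝ → L2 Ω) : ℝ :=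
  (eLpNorm f ⊤ (volume.restrict (Ici (0 : ℝ)))).toReal

/-- `f ∈ L^∞(ℝ₊; L²(Ω)²)`, given by a representative that respects the bound `‖f‖_∞` at every time
`t ≥ 0` (each class has one), so that its values at the time nodes are meaningful. -/
def IsForce {Ω : Set Plane} (f : ℝ → L2 Ω) : Prop :=
  MemLp f ⊤ (volume.restrict (Ici (0 : ℝ))) ∧ ∀ t : ℝ, 0 ≤ t → ‖f t‖ ≤ forceNorm f

/-! ## The DLN family with uniform step -/

/-- `(α₀, α₁, α₂)`. -/
def alpha (θ : ℝ) : Fin 3 → ℝ := ![(θ - 1) / 2, -θ, (θ + 1) / 2]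

/-- `(β₀, β₁, β₂)`. -/
def beta (θ : ℝ) : Fin 3 → ℝ := ![(2 - θ - θ ^ 2) / 4, θ ^ 2 / 2, (2 + θ - θ ^ 2) / 4]

/-- Coefficients `(a₀, a₁, a₂)` of the numerical dissipation. -/
def dissip (θ : ℝ) : Fin 3 → ℝ :=
  ![√(θ * (1 - θ ^ 2)) / √2 / 2, -(√(θ * (1 - θ ^ 2)) / √2), √(θ * (1 - θ ^ 2)) / √2 / 2]

/-- `∑_{ℓ=0}^{2} c_ℓ y_{n-1+ℓ}`, used for `n ≥ 1`. -/
def comb {M : Type*} [AddCommGroup M] [Module ℝ M] (c : Fin 3 → ℝ) (y : ℕ → M) (n : ℕ) : M :=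
  ∑ l : Fin 3, c l • y (n - 1 + (l : ℕ))

/-- The sequence `u` of velocities in `V` solves the fully implicit DLN scheme with step `dt`
and time nodes `t_n = n dt`: in `V'`, for every `n ≥ 1`,
`(1/dt) ∑ α_ℓ u_{n-1+ℓ} + ν A u_{n,β} + B(u_{n,β}, u_{n,β}) = f(t_{n,β})`. -/
def IsDLNSolution {Ω : Set Plane} (θ ν dt : ℝ) (f : ℝ → L2 Ω) (u : ℕ → V Ω) : Prop :=
  ∀ n : ℕ, 1 ≤ n → ∀ v : V Ω,
    1 / dt * inner ℝ (vel (comb (alpha θ) u n)) (vel v)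
      + ν * inner ℝ (grad (comb (beta θ) u n)) (grad v)
      + trilinear (comb (beta θ) u n) (comb (beta θ) u n) v
      = inner ℝ (f (comb (beta θ) (fun k : ℕ => (k : ℝ) * dt) n)) (vel v)

/-- The upper bound `C_{Δt}` of the time step. -/
def dtLimit (θ ν lam : ℝ) : ℝ :=
  1 / (ν * lam) *
    min (8 * θ * (1 - θ ^ 2) / (8 - 6 * θ ^ 2 + 3 * θ ^ 4)) (2 * (1 - θ))

/-- The squared `G(θ)`-norm of `(u, v)`. -/
def gNormSq {Ω : Set Plane} (θ : ℝ) (u v : L2 Ω) : ℝ :=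
  (1 + θ) / 4 * ‖u‖ ^ 2 + (1 - θ) / 4 * ‖v‖ ^ 2

/-- The squared `H`-norm of `(u, v)` for the matrix `H = diag(h₁₁ I, h₂₂ I)`. -/
def hNormSq {Ω : Set Plane} (h₁₁ h₂₂ : ℝ) (u v : L2 Ω) : ℝ :=
  h₁₁ * ‖u‖ ^ 2 + h₂₂ * ‖v‖ ^ 2

/-- The lower bound `(θ³/2) (1 - θ(1-θ)/2)` of `h₁₁`. -/
def hLower (θ : ℝ) : ℝ := θ ^ 3 / 2 * (1 - 1 / 2 * θ * (1 - θ))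

/-- `K₁ = C_h (‖u₁‖² + ‖u₀‖²) + C_ε F² / (2 ν² λ₁²)`; here `r₀ = ‖u₀‖`, `r₁ = ‖u₁‖`,
`F = ‖f‖_∞`. -/
def K1 (Ch Ce ν lam r₀ r₁ F : ℝ) : ℝ :=
  Ch * (r₁ ^ 2 + r₀ ^ 2) + Ce / (2 * ν ^ 2 * lam ^ 2) * F ^ 2

/-- `K₂ = (K₁ / ((θ³/2) (1 - θ(1-θ)/2)))^{1/2}`. -/
def K2 (θ Ch Ce ν lam r₀ r₁ F : ℝ) : ℝ := √(K1 Ch Ce ν lam r₀ r₁ F / hLower θ)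

end DLN

end

open DLN

/-!
The proof has an algebraic, an analytic and a dynamical part.

*Algebra.* Comparing coefficients, the modified dissipation identity is a system of six polynomial
equations for `ε, a, b, c, h₁₁, h₂₂`. The mixed equations prescribe `ab < 0`, `ac > 0`, `bc < 0` and
so determine `a, b, c`; then `h₂₂` is explicit and `1 + ε` is the positive root of a quadratic
equation. Evaluating the identity at `x = y = z` gives `ε (h₁₁ + h₂₂) = μ - (a + b + c)²` with
`μ = ν Δt λ₁ / 2`, and the first bound of the time step makes the right-hand side at least `μ / 64`,
because the cubic that decides this reduces to a linear function of `μ`. The second bound gives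
`h₁₁ > (θ³/2) (1 - θ(1-θ)/2)`. All this is in `exists_hNorm_coeffs`; the constants `C_h = 2` and
`C_ε = 512` do not depend on `θ`.

*Analysis.* Three facts about `V` on an arbitrary bounded open set are needed.
Ladyzhenskaya's inequality `‖u‖₄⁴ ≤ ½ ‖u‖² ‖∇u‖²` (`lintegral_pow_four_le`) bounds the trilinear
form (`advection_sq_le`); the constant `½` is exactly what the last estimate allows. The
identity `b(w, v, v) = 0` (`advection_self_eq_zero`) follows by integration by parts for test
functions and density. Poincaré's inequality `λ₁ ‖v‖² ≤ ‖∇v‖²` (`stokesLambda_mul_le`) requires that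
the infimum of the Rayleigh quotient is an eigenvalue, hence a minimizer. In place of a general
compact embedding theorem, `exists_friedrichs` bounds `‖v‖²` by finitely many squared averages over
grid cells plus `η ‖∇v‖²`; together with the parallelogram law, one value of `η` suffices for a
minimizing sequence to have a Cauchy subsequence.

*Dynamics.* Testing the scheme with `u_{n,β}` gives an energy inequality (`energy_step`). With half
of the viscous dissipation absorbed by the force, the other half either remains, which gives the sum
of the gradients, or feeds the modified dissipation identity, which gives the damped recursion
`(1 + ε) H_{n+1} ≤ H_n + κ` and with it the uniform bound `K₂`. Testing with `u_{n+1}`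
(`gradient_step`) and using `‖uₙ‖ ≤ K₂` bounds the convection term by a fraction of the dissipation
and a multiple of `‖∇u_{n,β}‖²`, whose sum is already under control.
-/

/-! ### Real algebra of the `G`- and `H`-norms -/

/-- Three numbers with prescribed pairwise products of signs `-, +, -`. -/
lemma exists_pairwise_products {P Q R : ℝ} (hP : P < 0) (hQ : 0 < Q) (hR : R < 0) :
    ∃ a b c : ℝ, a * b = P ∧ a * c = Q ∧ b * c = R ∧
      a ^ 2 * R = P * Q ∧ c ^ 2 * P = Q * R ∧
      (a + b + c) ^ 2 * (P * Q * R) = (P * Q + Q * R + R * P) ^ 2 := by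
  have hpos : 0 < P * Q / R := div_pos_of_neg_of_neg (mul_neg_of_neg_of_pos hP hQ) hR
  obtain ⟨a, ha, ha2⟩ : ∃ a : ℝ, 0 < a ∧ a ^ 2 = P * Q / R :=
    ⟨√(P * Q / R), Real.sqrt_pos.2 hpos, Real.sq_sqrt hpos.le⟩
  have h1 : a * (P / a) = P := by field_simp
  have h2 : a * (Q / a) = Q := by field_simp
  have h3 : P / a * (Q / a) = R := by
    rw [div_mul_div_comm, ← sq, ha2]
    have := hP.ne
    have := hR.ne
    field_simp
  refine ⟨a, P / a, Q / a, h1, h2, h3, ?_⟩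
  generalize P / a = b at *
  generalize Q / a = c at *
  subst h1 h2 h3
  refine ⟨by ring, by ring, by ring⟩

set_option maxHeartbeats 1000000 in
/-- The coefficients of the modified dissipation identity, as a solution of six polynomial
equations. Here `s = θ(1-θ²)/2` is the square of `a₁`. The off-diagonal equations determine
`a, b, c`, one diagonal equation gives `h₂₂`, and `1 + ε` is the positive root of a quadratic
equation. Adding all six equations, with the right multiplicities, yields
`ε (h₁₁ + h₂₂) = μ - (a + b + c)²`, from which the lower bound for `ε` follows. -/
lemma exists_hNorm_coeffs {θ μ : ℝ} (h0 : 0 < θ) (h1 : θ < 1) (hμ : 0 < μ)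
    (hμ1 : μ * (8 - 6 * θ ^ 2 + 3 * θ ^ 4) < 4 * (θ * (1 - θ ^ 2))) (hμ2 : μ < 1 - θ) :
    ∃ ε a b c h₁₁ h₂₂ : ℝ, 0 < ε ∧ ε < 4 ∧ μ / 64 ≤ ε * (h₁₁ + h₂₂) ∧
      hLower θ < h₁₁ ∧ h₁₁ < 2 ∧ (1 - θ) / 4 < h₂₂ ∧ h₂₂ < 2 ∧
      (1 + θ) / 4 + θ * (1 - θ ^ 2) / 2 / 4 + μ * beta θ 2 ^ 2 = (1 + ε) * h₁₁ + a ^ 2 ∧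
      (1 - θ) / 4 - (1 + θ) / 4 + θ * (1 - θ ^ 2) / 2 + μ * beta θ 1 ^ 2
        = (1 + ε) * h₂₂ - h₁₁ + b ^ 2 ∧
      -((1 - θ) / 4) + θ * (1 - θ ^ 2) / 2 / 4 + μ * beta θ 0 ^ 2 = -h₂₂ + c ^ 2 ∧
      a * b = -(θ * (1 - θ ^ 2) / 2) / 2 + μ * (beta θ 2 * beta θ 1) ∧
      a * c = θ * (1 - θ ^ 2) / 2 / 4 + μ * (beta θ 2 * beta θ 0) ∧
      b * c = -(θ * (1 - θ ^ 2) / 2) / 2 + μ * (beta θ 1 * beta θ 0) := by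
  obtain ⟨s, hs⟩ : ∃ s, s = θ * (1 - θ ^ 2) / 2 := ⟨_, rfl⟩
  have hθ2 : θ ^ 2 < 1 := pow_lt_one₀ h0.le h1 two_ne_zero
  have hs0 : 0 < s := by rw [hs]; have : 0 < 1 - θ ^ 2 := by linarith
                         positivity
  have hs1 : s < 1 / 2 := by rw [hs]; linarith [pow_pos h0 3]
  simp only [beta, Matrix.cons_val_zero, Matrix.cons_val_one, Matrix.cons_val]
  obtain ⟨b2, hb2⟩ : ∃ b, b = (2 + θ - θ ^ 2) / 4 := ⟨_, rfl⟩
  obtain ⟨b1, hb1⟩ : ∃ b, b = θ ^ 2 / 2 := ⟨_, rfl⟩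
  obtain ⟨b0, hb0⟩ : ∃ b, b = (2 - θ - θ ^ 2) / 4 := ⟨_, rfl⟩
  rw [← hs, ← hb2, ← hb1, ← hb0]
  have b0p : 0 < b0 := by rw [hb0]; linarith
  have b1p : 0 < b1 := by rw [hb1]; positivity
  have b20 : b2 - b0 = θ / 2 := by rw [hb2, hb0]; ring
  have b2p : 0 < b2 := by linarith
  have b2u : b2 ≤ 9 / 16 := by rw [hb2]; linarith [sq_nonneg (θ - 1 / 2)]
  have b0u : b0 ≤ 1 / 2 := by rw [hb0]; linarith [sq_nonneg θ]
  have b1u : b1 ≤ 1 / 2 := by rw [hb1]; linarith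
  have b02u : b2 * b0 ≤ 1 / 4 := by
    have : b2 * b0 = (1 - θ ^ 2) * (4 - θ ^ 2) / 16 := by rw [hb2, hb0]; ring
    rw [this]; linarith [mul_nonneg (sq_nonneg θ) (sub_nonneg.2 hθ2.le), sq_nonneg θ]
  have hb21 : (1 - θ) * (b2 * b1) ≤ s / 4 := by
    have : s / 4 - (1 - θ) * (b2 * b1) = θ * (1 - θ ^ 2) / 8 * (1 - θ) ^ 2 := by
      rw [hs, hb2, hb1]; ring
    have h : 0 ≤ θ * (1 - θ ^ 2) / 8 * (1 - θ) ^ 2 := by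
      have : 0 < 1 - θ ^ 2 := by linarith
      positivity
    linarith
  obtain ⟨P, hP⟩ : ∃ P, P = -s / 2 + μ * (b2 * b1) := ⟨_, rfl⟩
  obtain ⟨Q, hQ⟩ : ∃ Q, Q = s / 4 + μ * (b2 * b0) := ⟨_, rfl⟩
  obtain ⟨R, hR⟩ : ∃ R, R = -s / 2 + μ * (b1 * b0) := ⟨_, rfl⟩
  have hPu : P ≤ -s / 4 := by
    have : μ * (b2 * b1) ≤ (1 - θ) * (b2 * b1) := by gcongr
    linarith
  have hPR : R ≤ P := by
    rw [hP, hR]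
    have : b0 * b1 ≤ b2 * b1 := by gcongr; linarith
    have := mul_le_mul_of_nonneg_left this hμ.le
    linarith
  have hRl : -s / 2 ≤ R := by rw [hR]; have : 0 < μ * (b1 * b0) := by positivity
                              linarith
  have hP0 : P < 0 := by linarith
  have hR0 : R < 0 := by linarith
  have hQ0 : 0 < Q := by rw [hQ]; positivity
  have hQu : Q ≤ s / 4 + μ / 4 := by rw [hQ]; linarith [mul_le_mul_of_nonneg_left b02u hμ.le]
  obtain ⟨a, b, c, hab, hac, hbc, haR, hcP, habc⟩ := exists_pairwise_products hP0 hQ0 hR0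
  have haQ : a ^ 2 ≤ Q := by
    by_contra! h
    linarith [mul_lt_mul_of_neg_right h hR0, mul_le_mul_of_nonneg_right hPR hQ0.le]
  have hcQ : Q ≤ c ^ 2 := by
    by_contra! h
    linarith [mul_lt_mul_of_neg_right h hP0, mul_le_mul_of_nonneg_right hPR hQ0.le]
  have hcu : c ^ 2 ≤ 2 * Q := by
    by_contra! h
    have : 2 * P ≤ R := by linarith
    linarith [mul_lt_mul_of_neg_right h hP0, mul_le_mul_of_nonneg_right this hQ0.le]
  -- the defect `μ - (a + b + c)²` is at least `μ / 64`
  have hdefect : μ / 64 ≤ μ - (a + b + c) ^ 2 := by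
    obtain ⟨D, hD⟩ : ∃ D, D = s * (4 - 3 * θ ^ 2) / 16 - μ * (b0 * b1 * b2) := ⟨_, rfl⟩
    have e1 : P * Q + Q * R + R * P = -μ * D := by
      rw [hD, hP, hQ, hR, hb0, hb1, hb2]; ring
    have e2 : P * Q * R - μ * D ^ 2 = s ^ 2 * (16 * s - 3 * μ * θ ^ 2 * (4 - θ ^ 2)) / 256 := by
      rw [hD, hP, hQ, hR, hb0, hb1, hb2]; ring
    have hq5 : 5 ≤ 8 - 6 * θ ^ 2 + 3 * θ ^ 4 := by
      linarith [sq_nonneg (1 - θ ^ 2)]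
    have hq8 : 8 - 6 * θ ^ 2 + 3 * θ ^ 4 ≤ 8 := by
      linarith [mul_nonneg (sq_nonneg θ) (sub_nonneg.2 hθ2.le), sq_nonneg θ]
    have hμs : μ * (8 - 6 * θ ^ 2 + 3 * θ ^ 4) < 8 * s := by rw [hs]; linarith
    have e3 : s ≤ 16 * s - 3 * μ * θ ^ 2 * (4 - θ ^ 2) := by
      have k1 : 3 * θ ^ 2 * (4 - θ ^ 2) * (μ * (8 - 6 * θ ^ 2 + 3 * θ ^ 4))
          ≤ 3 * θ ^ 2 * (4 - θ ^ 2) * (8 * s) := by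
        have : 0 < 4 - θ ^ 2 := by linarith
        gcongr
      have k2 : 1 ≤ (4 - 3 * θ ^ 2) ^ 2 := one_le_pow₀ (by linarith)
      have k3 : s * (8 - 6 * θ ^ 2 + 3 * θ ^ 4) ≤ s * (8 * (4 - 3 * θ ^ 2) ^ 2) := by
        gcongr
        linarith
      by_contra! h
      linarith [mul_lt_mul_of_pos_right h (by linarith : 0 < 8 - 6 * θ ^ 2 + 3 * θ ^ 4)]
    have hμ5 : μ * 5 ≤ 8 * s := by linarith [mul_le_mul_of_nonneg_left hq5 hμ.le]
    have hQs : Q ≤ s * (13 / 20) := by linarith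
    have hPRs : P * R ≤ s ^ 2 / 4 := by
      have : -P * -R ≤ s / 2 * (s / 2) := by gcongr <;> linarith
      linarith
    have hPRpos : 0 < P * R := mul_pos_of_neg_of_neg hP0 hR0
    have hprod : P * Q * R ≤ s ^ 3 * (13 / 80) := by
      calc P * Q * R = P * R * Q := by ring
        _ ≤ s ^ 2 / 4 * (s * (13 / 20)) := by gcongr
        _ = _ := by ring
    have hpos : 0 < P * Q * R := by
      have := mul_pos hPRpos hQ0
      linarith [this, show P * Q * R = P * R * Q by ring]
    have e4 : μ * D ^ 2 ≤ 63 / 64 * (P * Q * R) := by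
      have : s ^ 2 * s ≤ s ^ 2 * (16 * s - 3 * μ * θ ^ 2 * (4 - θ ^ 2)) := by gcongr
      have : 0 < s ^ 3 := by positivity
      linarith
    have e5 : (a + b + c) ^ 2 * (P * Q * R) ≤ 63 / 64 * μ * (P * Q * R) := by
      rw [habc, e1]
      linarith [mul_le_mul_of_nonneg_left e4 hμ.le]
    have := le_of_mul_le_mul_right e5 hpos
    linarith
  obtain ⟨h22, hh22⟩ : ∃ h, h = (1 - θ) / 4 - s / 4 - μ * b0 ^ 2 + c ^ 2 := ⟨_, rfl⟩
  obtain ⟨X, hX⟩ : ∃ X, X = (1 + θ) / 4 + s / 4 + μ * b2 ^ 2 - a ^ 2 := ⟨_, rfl⟩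
  obtain ⟨Y, hY⟩ : ∃ Y, Y = -θ / 2 + s + μ * b1 ^ 2 - b ^ 2 := ⟨_, rfl⟩
  have hh22l : (1 - θ) / 4 < h22 := by
    have : 0 < μ * (b0 * (θ / 2)) := by positivity
    have e : μ * (b2 * b0) - μ * b0 ^ 2 = μ * (b0 * (θ / 2)) := by rw [← b20]; ring
    linarith
  have hh22u : h22 < 2 := by
    have : 0 ≤ μ * b0 ^ 2 := by positivity
    linarith
  have h22p : 0 < h22 := by linarith
  have hXl : (1 + θ) / 4 < X := by
    have : 0 < μ * (b2 * (θ / 2)) := by positivity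
    have e : μ * b2 ^ 2 - μ * (b2 * b0) = μ * (b2 * (θ / 2)) := by rw [← b20]; ring
    linarith
  have hXu : X ≤ (1 + θ) / 4 + s / 4 + (1 - θ) * (81 / 256) := by
    have k : b2 ^ 2 ≤ (9 / 16) ^ 2 := by gcongr
    have : μ * b2 ^ 2 ≤ (1 - θ) * (9 / 16) ^ 2 := by gcongr
    have := sq_nonneg a
    linarith
  -- the step bound `μ < 1 - θ` enters the lower bound for `h₁₁` through `b₁² = θ⁴/4`
  have hYL : Y < -hLower θ := by
    have k : μ * b1 ^ 2 < (1 - θ) * b1 ^ 2 := by gcongr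
    have e : -θ / 2 + s + (1 - θ) * b1 ^ 2 = -hLower θ := by
      rw [hs, hb1, hLower]; ring
    have := sq_nonneg b
    linarith
  have hL : 0 < hLower θ := by
    have : 0 < 1 - 1 / 2 * θ * (1 - θ) := by linarith [sq_nonneg (θ - 1 / 2)]
    rw [hLower]; positivity
  -- `e = 1 + ε` is the positive root of `h₂₂ e² - Y e - X`
  obtain ⟨e, he⟩ : ∃ e, e = (Y + √(Y ^ 2 + 4 * h22 * X)) / (2 * h22) := ⟨_, rfl⟩
  have hdisc : Y ^ 2 < Y ^ 2 + 4 * h22 * X := by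
    have : 0 < X := by linarith
    have : 0 < h22 * X := by positivity
    linarith
  have he0 : 0 < e := by
    rw [he]
    apply div_pos _ (by positivity)
    have : √(Y ^ 2) < √(Y ^ 2 + 4 * h22 * X) := Real.sqrt_lt_sqrt (sq_nonneg _) hdisc
    rw [Real.sqrt_sq_eq_abs] at this
    have := neg_abs_le Y
    linarith
  have hroot : h22 * e ^ 2 - Y * e - X = 0 := by
    have h := Real.sq_sqrt ((sq_nonneg Y).trans hdisc.le)
    have h3 : 2 * h22 * e - Y = √(Y ^ 2 + 4 * h22 * X) := by
      rw [he]; field_simp; ring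
    rw [← h3] at h
    have : 4 * h22 * (h22 * e ^ 2 - Y * e - X) = 0 := by linarith
    rcases mul_eq_zero.1 this with h4 | h4
    · linarith
    · exact h4
  obtain ⟨h11, hh11⟩ : ∃ h, h = e * h22 - Y := ⟨_, rfl⟩
  have h11l : hLower θ < h11 := by
    have : 0 < e * h22 := by positivity
    linarith
  have hXe : X = e * h11 := by rw [hh11]; linarith
  have hsum : (e - 1) * (h11 + h22) = μ - (a + b + c) ^ 2 := by
    have hsq : (a + b + c) ^ 2 = a ^ 2 + b ^ 2 + c ^ 2 + 2 * (P + Q + R) := by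
      rw [← hab, ← hac, ← hbc]; ring
    have hone : b0 + b1 + b2 = 1 := by rw [hb0, hb1, hb2]; ring
    have hone2 : b0 ^ 2 + b1 ^ 2 + b2 ^ 2 + 2 * (b2 * b1 + b2 * b0 + b1 * b0) = 1 := by
      linear_combination (b0 + b1 + b2 + 1) * hone
    have : (e - 1) * (h11 + h22) = X + Y - h22 := by rw [hXe, hh11]; ring
    rw [this, hsq, hX, hY, hh22, hP, hQ, hR]
    linear_combination μ * hone2
  have he1 : 1 < e := by
    by_contra! h
    have := mul_nonneg (sub_nonneg.2 h) (by linarith : 0 ≤ h11 + h22)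
    linarith
  have he5 : e < 5 := by
    by_contra! h
    have k1 : (25 : ℝ) * h22 - 5 * Y - X ≤ 0 := by
      have : 0 < h22 * (e + 5) := by positivity
      have := mul_nonneg (sub_nonneg.2 h) (by linarith : 0 ≤ h22 * (e + 5) - Y)
      linarith
    have k2 : 0 < 25 * ((1 - θ) / 4) + 5 * hLower θ
        - ((1 + θ) / 4 + s / 4 + (1 - θ) * (81 / 256)) := by
      have k3 : 7 / 8 ≤ 1 - 1 / 2 * θ * (1 - θ) := by linarith [sq_nonneg (θ - 1 / 2)]
      have k4 : θ ^ 3 / 2 * (7 / 8) ≤ hLower θ := by rw [hLower]; gcongr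
      have k5 : 0 ≤ (θ - 1) ^ 2 * (θ + 2) := by positivity
      linarith
    linarith
  have h11u : h11 < 2 := by
    have := mul_le_mul_of_nonneg_right he1.le (hL.trans h11l).le
    linarith
  refine ⟨e - 1, a, b, c, h11, h22, by linarith, by linarith, by rw [hsum]; exact hdefect,
    h11l, h11u, hh22l, hh22u, ?_, ?_, ?_, ?_, ?_, ?_⟩
  · rw [add_sub_cancel, ← hXe, hX]; ring
  · rw [add_sub_cancel, hh11, hY]; ring
  · rw [hh22]; ring
  · rw [hab, hP, neg_div]
  · rw [hac, hQ]
  · rw [hbc, hR, neg_div]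

section InnerProduct

variable {E : Type*} [NormedAddCommGroup E] [InnerProductSpace ℝ E]

lemma inner_three_smul (a b c a' b' c' : ℝ) (x y z : E) :
    inner ℝ (a • x + b • y + c • z) (a' • x + b' • y + c' • z)
      = a * a' * ‖x‖ ^ 2 + b * b' * ‖y‖ ^ 2 + c * c' * ‖z‖ ^ 2
        + (a * b' + b * a') * inner ℝ x y + (a * c' + c * a') * inner ℝ x z
        + (b * c' + c * b') * inner ℝ y z := by
  simp only [inner_add_left, inner_add_right, real_inner_smul_left, real_inner_smul_right,
    real_inner_self_eq_norm_sq, real_inner_comm x y, real_inner_comm x z, real_inner_comm y z]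
  ring

lemma norm_three_smul_sq (a b c : ℝ) (x y z : E) :
    ‖a • x + b • y + c • z‖ ^ 2
      = a ^ 2 * ‖x‖ ^ 2 + b ^ 2 * ‖y‖ ^ 2 + c ^ 2 * ‖z‖ ^ 2
        + 2 * (a * b) * inner ℝ x y + 2 * (a * c) * inner ℝ x z + 2 * (b * c) * inner ℝ y z := by
  rw [← real_inner_self_eq_norm_sq, inner_three_smul]
  ring

/-- The gradient part of the scheme tested with `u_{n+1}`: the energy
`‖x‖²/4 + (β₀/2 + δ) ‖y‖²`, `δ = (2β₂-1)/8`, telescopes and leaves `6δ‖x‖² + δ‖y‖² + δ‖z‖²`. -/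
lemma inner_beta_first {θ : ℝ} (x y z : E) :
    inner ℝ (beta θ 2 • x + beta θ 1 • y + beta θ 0 • z) x
      = (1 / 4 * ‖x‖ ^ 2 + (beta θ 0 / 2 + (2 * beta θ 2 - 1) / 8) * ‖y‖ ^ 2)
        - (1 / 4 * ‖y‖ ^ 2 + (beta θ 0 / 2 + (2 * beta θ 2 - 1) / 8) * ‖z‖ ^ 2)
        + (beta θ 1 / 2 * ‖x + y‖ ^ 2 + beta θ 0 / 2 * ‖x + z‖ ^ 2)
        + (2 * beta θ 2 - 1) / 8 * (6 * ‖x‖ ^ 2 + ‖y‖ ^ 2 + ‖z‖ ^ 2) := by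
  rw [norm_add_sq_real, norm_add_sq_real]
  simp only [inner_add_left, real_inner_smul_left, real_inner_self_eq_norm_sq,
    real_inner_comm x y, real_inner_comm x z]
  simp only [beta, Matrix.cons_val_zero, Matrix.cons_val_one, Matrix.cons_val]
  ring

end InnerProduct

section GNorm

variable {Ω : Set Plane}

/-- `G`-stability of the DLN family. -/
lemma inner_alpha_beta {θ : ℝ} (h0 : 0 < θ) (h1 : θ < 1) (x y z : L2 Ω) :
    inner ℝ (alpha θ 2 • x + alpha θ 1 • y + alpha θ 0 • z)
        (beta θ 2 • x + beta θ 1 • y + beta θ 0 • z)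
      = gNormSq θ x y - gNormSq θ y z
        + ‖dissip θ 2 • x + dissip θ 1 • y + dissip θ 0 • z‖ ^ 2 := by
  rw [inner_three_smul, norm_three_smul_sq]
  have hr : (√(θ * (1 - θ ^ 2)) / √2) ^ 2 = θ * (1 - θ ^ 2) / 2 := by
    have : 0 ≤ 1 - θ ^ 2 := sub_nonneg.2 (pow_le_one₀ h0.le h1.le)
    rw [div_pow, Real.sq_sqrt (by positivity), Real.sq_sqrt (by norm_num)]
  simp only [alpha, beta, dissip, gNormSq, Matrix.cons_val_zero, Matrix.cons_val_one,
    Matrix.cons_val]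
  generalize √(θ * (1 - θ ^ 2)) / √2 = r at *
  linear_combination (-(‖x‖ ^ 2 / 4 + ‖y‖ ^ 2 + ‖z‖ ^ 2 / 4 - inner ℝ x y + inner ℝ x z / 2
    - inner ℝ y z)) * hr

lemma inner_alpha_first {θ : ℝ} (x y z : L2 Ω) :
    inner ℝ (alpha θ 2 • x + alpha θ 1 • y + alpha θ 0 • z) x
      = gNormSq θ x y - gNormSq θ y z
        + (θ / 2 * ‖x - y‖ ^ 2 + 1 / 4 * (1 - θ) * ‖x - z‖ ^ 2) := by
  rw [norm_sub_sq_real, norm_sub_sq_real]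
  simp only [inner_add_left, real_inner_smul_left, real_inner_self_eq_norm_sq,
    real_inner_comm x y, real_inner_comm x z]
  simp only [alpha, gNormSq, Matrix.cons_val_zero, Matrix.cons_val_one, Matrix.cons_val]
  ring

lemma gNormSq_nonneg {θ : ℝ} (h0 : 0 < θ) (h1 : θ < 1) (x y : L2 Ω) : 0 ≤ gNormSq θ x y := by
  have : 0 < 1 - θ := by linarith
  unfold gNormSq
  positivity

/-- The modified dissipation identity, reduced to the equality of the coefficients. -/
lemma gNormSq_sub_eq_hNormSq {θ μ ε a b c h₁₁ h₂₂ : ℝ} (h0 : 0 < θ) (h1 : θ < 1)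
    (hxx : (1 + θ) / 4 + θ * (1 - θ ^ 2) / 2 / 4 + μ * beta θ 2 ^ 2 = (1 + ε) * h₁₁ + a ^ 2)
    (hyy : (1 - θ) / 4 - (1 + θ) / 4 + θ * (1 - θ ^ 2) / 2 + μ * beta θ 1 ^ 2
      = (1 + ε) * h₂₂ - h₁₁ + b ^ 2)
    (hzz : -((1 - θ) / 4) + θ * (1 - θ ^ 2) / 2 / 4 + μ * beta θ 0 ^ 2 = -h₂₂ + c ^ 2)
    (hxy : a * b = -(θ * (1 - θ ^ 2) / 2) / 2 + μ * (beta θ 2 * beta θ 1))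
    (hxz : a * c = θ * (1 - θ ^ 2) / 2 / 4 + μ * (beta θ 2 * beta θ 0))
    (hyz : b * c = -(θ * (1 - θ ^ 2) / 2) / 2 + μ * (beta θ 1 * beta θ 0)) (x y z : L2 Ω) :
    gNormSq θ x y - gNormSq θ y z
        + ‖dissip θ 2 • x + dissip θ 1 • y + dissip θ 0 • z‖ ^ 2
        + μ * ‖beta θ 2 • x + beta θ 1 • y + beta θ 0 • z‖ ^ 2
      = (1 + ε) * hNormSq h₁₁ h₂₂ x y - hNormSq h₁₁ h₂₂ y z + ‖a • x + b • y + c • z‖ ^ 2 := by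
  simp only [norm_three_smul_sq]
  have hr : (√(θ * (1 - θ ^ 2)) / √2) ^ 2 = θ * (1 - θ ^ 2) / 2 := by
    have : 0 ≤ 1 - θ ^ 2 := sub_nonneg.2 (pow_le_one₀ h0.le h1.le)
    rw [div_pow, Real.sq_sqrt (by positivity), Real.sq_sqrt (by norm_num)]
  generalize beta θ 0 = b0 at *
  generalize beta θ 1 = b1 at *
  generalize beta θ 2 = b2 at *
  simp only [dissip, gNormSq, hNormSq, Matrix.cons_val_zero, Matrix.cons_val_one,
    Matrix.cons_val]
  generalize √(θ * (1 - θ ^ 2)) / √2 = r at *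
  linear_combination (‖x‖ ^ 2 / 4 + ‖y‖ ^ 2 + ‖z‖ ^ 2 / 4 - inner ℝ x y + inner ℝ x z / 2
    - inner ℝ y z) * hr + ‖x‖ ^ 2 * hxx + ‖y‖ ^ 2 * hyy + ‖z‖ ^ 2 * hzz
    - 2 * inner ℝ x y * hxy - 2 * inner ℝ x z * hxz - 2 * inner ℝ y z * hyz

end GNorm

/-! ### Integral inequalities on intervals and squares -/

section Interval

variable {F : Type*} [NormedAddCommGroup F] [InnerProductSpace ℝ F]

/-- The Cauchy–Schwarz inequality for real functions with integrable squares. -/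
lemma sq_integral_mul_le {α : Type*} [MeasurableSpace α] {μ : Measure α} {f g : α → ℝ}
    (hf : MemLp f 2 μ) (hg : MemLp g 2 μ) :
    (∫ x, f x * g x ∂μ) ^ 2 ≤ (∫ x, f x ^ 2 ∂μ) * ∫ x, g x ^ 2 ∂μ := by
  have hf2 := hf.integrable_sq
  have hg2 := hg.integrable_sq
  have hfg : Integrable (fun x => f x * g x) μ := hf.integrable_mul hg
  have key : ∀ t : ℝ, 0 ≤ (∫ x, g x ^ 2 ∂μ) * (t * t) + (2 * ∫ x, f x * g x ∂μ) * t
      + ∫ x, f x ^ 2 ∂μ := by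
    intro t
    have : (∫ x, g x ^ 2 ∂μ) * (t * t) + (2 * ∫ x, f x * g x ∂μ) * t + ∫ x, f x ^ 2 ∂μ
        = ∫ x, (f x + t * g x) ^ 2 ∂μ := by
      rw [show (fun x => (f x + t * g x) ^ 2)
        = fun x => (t * t) * g x ^ 2 + (2 * t) * (f x * g x) + f x ^ 2 by funext x; ring]
      have hadd : Integrable (fun x => (t * t) * g x ^ 2 + (2 * t) * (f x * g x)) μ :=
        (hg2.const_mul _).add (hfg.const_mul _)
      rw [integral_add hadd hf2,
        integral_add (hg2.const_mul _) (hfg.const_mul _), integral_const_mul, integral_const_mul]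
      ring
    rw [this]
    exact integral_nonneg fun x => sq_nonneg _
  have := discrim_le_zero key
  rw [discrim] at this
  linarith

lemma sq_intervalIntegral_le {f : ℝ → ℝ} (hf : Continuous f) {a b : ℝ} (hab : a ≤ b) :
    (∫ x in a..b, f x) ^ 2 ≤ (b - a) * ∫ x in a..b, f x ^ 2 := by
  simp only [intervalIntegral.integral_of_le hab]
  have hf2 : MemLp f 2 (volume.restrict (Ioc a b)) := by
    obtain ⟨C, hC⟩ := isCompact_Icc.exists_bound_of_continuousOn (s := Icc a b) hf.continuousOn
    refine MemLp.of_bound hf.aestronglyMeasurable C ?_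
    filter_upwards [ae_restrict_mem measurableSet_Ioc] with x hx
    exact hC x (Ioc_subset_Icc_self hx)
  have := sq_integral_mul_le hf2 (memLp_const (1 : ℝ))
  simpa [hab, mul_comm] using this

/-- A Poincaré–Wirtinger inequality: the mean and the oscillation control the `L²`-norm. -/
lemma integral_norm_sq_le_mean_add_osc [CompleteSpace F] {g : ℝ → F} (hg : Continuous g)
    {a h K : ℝ} (hh : 0 < h)
    (hK : ∀ x ∈ Icc a (a + h), ∀ y ∈ Icc a (a + h), ‖g x - g y‖ ≤ K) :
    ∫ x in a..a + h, ‖g x‖ ^ 2 ≤ h⁻¹ * ‖∫ x in a..a + h, g x‖ ^ 2 + h * K ^ 2 := by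
  set S := ∫ x in a..a + h, g x with hS
  have hle : a ≤ a + h := by linarith
  have hosc : ∀ x ∈ Icc a (a + h), ‖g x - h⁻¹ • S‖ ≤ K := by
    intro x hx
    have e : g x - h⁻¹ • S = h⁻¹ • ∫ y in a..a + h, (g x - g y) := by
      rw [intervalIntegral.integral_sub (by simp) (hg.intervalIntegrable _ _), smul_sub,
        intervalIntegral.integral_const, smul_smul]
      simp [hh.ne']
      rfl
    rw [e, norm_smul]
    have := intervalIntegral.norm_integral_le_of_norm_le_const (a := a) (b := a + h)
      (f := fun y => g x - g y) (C := K) (fun y hy => by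
        rw [uIoc_of_le hle] at hy
        exact hK x hx y (Ioc_subset_Icc_self hy))
    rw [add_sub_cancel_left, abs_of_pos hh] at this
    calc ‖h⁻¹‖ * _ ≤ ‖h⁻¹‖ * (K * h) := by gcongr
      _ = K := by rw [Real.norm_of_nonneg (by positivity)]; field_simp
  have e1 : ∫ x in a..a + h, ‖g x‖ ^ 2
      = (∫ x in a..a + h, ‖g x - h⁻¹ • S‖ ^ 2) + h⁻¹ * ‖S‖ ^ 2 := by
    have e2 : ∀ x, ‖g x‖ ^ 2 = ‖g x - h⁻¹ • S‖ ^ 2 + 2 * h⁻¹ * inner ℝ S (g x)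
        - h⁻¹ ^ 2 * ‖S‖ ^ 2 := by
      intro x
      rw [norm_sub_sq_real, norm_smul, real_inner_smul_right, Real.norm_of_nonneg (by positivity),
        real_inner_comm]
      ring
    simp_rw [e2]
    have c1 : Continuous fun x => ‖g x - h⁻¹ • S‖ ^ 2 := by fun_prop
    have c2 : Continuous fun x => 2 * h⁻¹ * inner ℝ S (g x) := by fun_prop
    have c3 : Continuous fun x => ‖g x - h⁻¹ • S‖ ^ 2 + 2 * h⁻¹ * inner ℝ S (g x) := c1.add c2
    rw [intervalIntegral.integral_sub (c3.intervalIntegrable _ _) intervalIntegrable_const,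
      intervalIntegral.integral_add (c1.intervalIntegrable _ _) (c2.intervalIntegrable _ _),
      intervalIntegral.integral_const_mul, intervalIntegral.integral_const]
    have e3 : ∫ x in a..a + h, inner ℝ S (g x) = ‖S‖ ^ 2 := by
      rw [intervalIntegral.integral_of_le hle,
        integral_inner (hg.intervalIntegrable (μ := volume) _ _).1,
        ← intervalIntegral.integral_of_le hle, ← hS, real_inner_self_eq_norm_sq]
    rw [e3, smul_eq_mul]
    field_simp
    ring
  have e4 : ∫ x in a..a + h, ‖g x - h⁻¹ • S‖ ^ 2 ≤ h * K ^ 2 := by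
    have c1 : Continuous fun x => ‖g x - h⁻¹ • S‖ ^ 2 := by fun_prop
    have := intervalIntegral.integral_mono_on (μ := volume) hle (c1.intervalIntegrable _ _)
      (by simp : IntervalIntegrable (fun _ => K ^ 2) volume a (a + h)) (fun x hx => by
        have := hosc x hx
        gcongr)
    simpa using this
  linarith

lemma norm_sub_le_integral_norm_deriv [CompleteSpace F] {g g' : ℝ → F}
    (hg : ∀ x, HasDerivAt g (g' x) x)
    (hg' : Continuous g') {a b : ℝ} {x y : ℝ} (hx : x ∈ Icc a b) (hy : y ∈ Icc a b) :
    ‖g x - g y‖ ≤ ∫ t in a..b, ‖g' t‖ := by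
  have h1 := intervalIntegral.integral_eq_sub_of_hasDerivAt (a := y) (b := x) (f := g)
    (fun t _ => hg t) (hg'.intervalIntegrable _ _)
  rw [← h1]
  refine intervalIntegral.norm_integral_le_integral_norm_uIoc.trans ?_
  rw [intervalIntegral.integral_of_le (hx.1.trans hx.2)]
  refine setIntegral_mono_set (hg'.norm.integrableOn_Ioc) (.of_forall fun _ => norm_nonneg _)
    (LE.le.eventuallyLE ?_)
  intro t ht
  exact ⟨(le_min hy.1 hx.1).trans_lt ht.1, ht.2.trans (max_le hy.2 hx.2)⟩

lemma norm_sq_le_integral_norm_mul_norm_deriv {g g' : ℝ → F} (hg : ∀ x, HasDerivAt g (g' x) x)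
    (hg' : Continuous g') {a b x : ℝ} (hx : x ∈ Icc a b) (ha : g a = 0) (hb : g b = 0) :
    ‖g x‖ ^ 2 ≤ ∫ t in a..b, ‖g t‖ * ‖g' t‖ := by
  have hgc : Continuous g := continuous_iff_continuousAt.2 fun x => (hg x).continuousAt
  have hd : ∀ t, HasDerivAt (fun t => ‖g t‖ ^ 2) (2 * inner ℝ (g t) (g' t)) t :=
    fun t => (hg t).norm_sq
  have hc : Continuous fun t => 2 * inner ℝ (g t) (g' t) := by fun_prop
  have hm : Continuous fun t => ‖g t‖ * ‖g' t‖ := by fun_prop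
  have h1 := intervalIntegral.integral_eq_sub_of_hasDerivAt (a := a) (b := x)
    (fun t _ => hd t) (hc.intervalIntegrable _ _)
  have h2 := intervalIntegral.integral_eq_sub_of_hasDerivAt (a := x) (b := b)
    (fun t _ => hd t) (hc.intervalIntegrable _ _)
  have h3 := intervalIntegral.integral_mono_on (μ := volume) hx.1 (hc.intervalIntegrable a x)
    ((hm.const_mul 2).intervalIntegrable a x) (fun t _ =>
      mul_le_mul_of_nonneg_left (real_inner_le_norm (g t) (g' t)) zero_le_two)
  have h4 := intervalIntegral.integral_mono_on (μ := volume) hx.2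
    ((hm.const_mul (-2)).intervalIntegrable x b) (hc.intervalIntegrable x b) (fun t _ => by
      have := neg_le_of_abs_le (abs_real_inner_le_norm (g t) (g' t))
      linarith)
  have h5 := intervalIntegral.integral_add_adjacent_intervals (μ := volume)
    (hm.intervalIntegrable a x) (hm.intervalIntegrable x b)
  simp only [intervalIntegral.integral_const_mul, ha, hb, norm_zero] at h1 h2 h3 h4
  linarith

end Interval

section Plane

variable {F : Type*} [NormedAddCommGroup F] [InnerProductSpace ℝ F]

lemma continuous_intervalIntegral_left {E : Type*} [NormedAddCommGroup E] [NormedSpace ℝ E]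
    {g : ℝ → ℝ → E} (hg : Continuous (Function.uncurry g)) (a b : ℝ) :
    Continuous fun y => ∫ x in a..b, g x y :=
  intervalIntegral.continuous_parametric_intervalIntegral_of_continuous'
    (f := fun y x => g x y) (by exact hg.comp continuous_swap) a b

lemma intervalIntegral_swap {E : Type*} [NormedAddCommGroup E] [NormedSpace ℝ E]
    {g : ℝ → ℝ → E} (hg : Continuous (Function.uncurry g)) {a b c d : ℝ} (hab : a ≤ b)
    (hcd : c ≤ d) :
    ∫ y in c..d, ∫ x in a..b, g x y = ∫ x in a..b, ∫ y in c..d, g x y := by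
  simp only [intervalIntegral.integral_of_le hab, intervalIntegral.integral_of_le hcd]
  refine integral_integral_swap (f := fun y x => g x y) ?_
  rw [Measure.prod_restrict]
  have : Continuous (Function.uncurry fun y x => g x y) := hg.comp continuous_swap
  refine (this.continuousOn.integrableOn_compact (K := Icc c d ×ˢ Icc a b)
    (isCompact_Icc.prod isCompact_Icc)).mono_set ?_
  exact prod_mono Ioc_subset_Icc_self Ioc_subset_Icc_self

/-- Poincaré's inequality on a square of side `h`. -/
lemma integral_square_norm_sq_le [CompleteSpace F] {g g₁ g₂ : ℝ → ℝ → F}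
    (hg : Continuous (Function.uncurry g))
    (hg₁ : Continuous (Function.uncurry g₁)) (hg₂ : Continuous (Function.uncurry g₂))
    (hd₁ : ∀ x y, HasDerivAt (fun s => g s y) (g₁ x y) x)
    (hd₂ : ∀ x y, HasDerivAt (fun s => g x s) (g₂ x y) y) {a b h : ℝ} (hh : 0 < h) :
    ∫ y in b..b + h, ∫ x in a..a + h, ‖g x y‖ ^ 2
      ≤ h⁻¹ ^ 2 * ‖∫ y in b..b + h, ∫ x in a..a + h, g x y‖ ^ 2
        + h ^ 2 * ((∫ y in b..b + h, ∫ x in a..a + h, ‖g₁ x y‖ ^ 2)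
          + ∫ y in b..b + h, ∫ x in a..a + h, ‖g₂ x y‖ ^ 2) := by
  have hax : a ≤ a + h := by linarith
  have hby : b ≤ b + h := by linarith
  have cx : ∀ {G : ℝ → ℝ → F}, Continuous (Function.uncurry G) → ∀ y, Continuous fun x => G x y :=
    fun hG y => hG.comp (Continuous.prodMk_left y)
  have cy : ∀ {G : ℝ → ℝ → F}, Continuous (Function.uncurry G) → ∀ x, Continuous fun y => G x y :=
    fun hG x => hG.comp (Continuous.prodMk_right x)
  have cn1 : Continuous (Function.uncurry fun x y => ‖g₁ x y‖) := hg₁.norm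
  have cn2 : Continuous (Function.uncurry fun x y => ‖g₂ x y‖) := hg₂.norm
  have cs : Continuous (Function.uncurry fun x y => ‖g x y‖ ^ 2) := hg.norm.pow 2
  have cs1 : Continuous (Function.uncurry fun x y => ‖g₁ x y‖ ^ 2) := hg₁.norm.pow 2
  have cs2 : Continuous (Function.uncurry fun x y => ‖g₂ x y‖ ^ 2) := hg₂.norm.pow 2
  -- the inequality in the first variable, integrated over the second
  have s1 : ∀ y, ∫ x in a..a + h, ‖g x y‖ ^ 2
      ≤ h⁻¹ * ‖∫ x in a..a + h, g x y‖ ^ 2 + h ^ 2 * ∫ x in a..a + h, ‖g₁ x y‖ ^ 2 := by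
    intro y
    have k1 := integral_norm_sq_le_mean_add_osc (cx hg y) (a := a) hh
      (fun x hx x' hx' => norm_sub_le_integral_norm_deriv (fun s => hd₁ s y) (cx hg₁ y) hx hx')
    have k2 := sq_intervalIntegral_le (cx hg₁ y).norm hax
    rw [add_sub_cancel_left] at k2
    linarith [mul_le_mul_of_nonneg_left k2 hh.le]
  have cV := continuous_intervalIntegral_left hg a (a + h)
  have s2 : ∫ y in b..b + h, ∫ x in a..a + h, ‖g x y‖ ^ 2
      ≤ h⁻¹ * (∫ y in b..b + h, ‖∫ x in a..a + h, g x y‖ ^ 2)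
        + h ^ 2 * ∫ y in b..b + h, ∫ x in a..a + h, ‖g₁ x y‖ ^ 2 := by
    have c1 : Continuous fun y => h⁻¹ * ‖∫ x in a..a + h, g x y‖ ^ 2 := by fun_prop
    have c2 : Continuous fun y => h ^ 2 * ∫ x in a..a + h, ‖g₁ x y‖ ^ 2 :=
      (continuous_intervalIntegral_left cs1 a (a + h)).const_mul (h ^ 2)
    have c3 : Continuous fun y => h⁻¹ * ‖∫ x in a..a + h, g x y‖ ^ 2
        + h ^ 2 * ∫ x in a..a + h, ‖g₁ x y‖ ^ 2 := c1.add c2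
    have := intervalIntegral.integral_mono_on (μ := volume) hby
      ((continuous_intervalIntegral_left cs a (a + h)).intervalIntegrable _ _)
      (c3.intervalIntegrable b (b + h)) (fun y _ => s1 y)
    rwa [intervalIntegral.integral_add (c1.intervalIntegrable _ _) (c2.intervalIntegrable _ _),
      intervalIntegral.integral_const_mul, intervalIntegral.integral_const_mul] at this
  -- the inequality in the second variable for the partial means
  have s3 : ∀ y ∈ Icc b (b + h), ∀ y' ∈ Icc b (b + h),
      ‖(∫ x in a..a + h, g x y) - ∫ x in a..a + h, g x y'‖
        ≤ ∫ x in a..a + h, ∫ y in b..b + h, ‖g₂ x y‖ := by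
    intro y hy y' hy'
    rw [← intervalIntegral.integral_sub ((cx hg y).intervalIntegrable _ _)
      ((cx hg y').intervalIntegrable _ _)]
    refine (intervalIntegral.norm_integral_le_integral_norm hax).trans ?_
    have c1 : Continuous fun x => ‖g x y - g x y'‖ := ((cx hg y).sub (cx hg y')).norm
    have c2 : Continuous fun x => ∫ y in b..b + h, ‖g₂ x y‖ :=
      intervalIntegral.continuous_parametric_intervalIntegral_of_continuous' cn2 _ _
    exact intervalIntegral.integral_mono_on (μ := volume) hax (c1.intervalIntegrable _ _)
      (c2.intervalIntegrable _ _) (fun x _ =>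
        norm_sub_le_integral_norm_deriv (fun s => hd₂ x s) (cy hg₂ x) hy hy')
  have s4 := integral_norm_sq_le_mean_add_osc cV hh s3
  have s5 : (∫ x in a..a + h, ∫ y in b..b + h, ‖g₂ x y‖) ^ 2
      ≤ h ^ 2 * ∫ y in b..b + h, ∫ x in a..a + h, ‖g₂ x y‖ ^ 2 := by
    have c2 : Continuous fun x => ∫ y in b..b + h, ‖g₂ x y‖ :=
      intervalIntegral.continuous_parametric_intervalIntegral_of_continuous' cn2 _ _
    have c3 : Continuous fun x => ∫ y in b..b + h, ‖g₂ x y‖ ^ 2 :=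
      intervalIntegral.continuous_parametric_intervalIntegral_of_continuous' cs2 _ _
    have c4 : Continuous fun x => (∫ y in b..b + h, ‖g₂ x y‖) ^ 2 := c2.pow 2
    have k1 := sq_intervalIntegral_le c2 hax
    have k2 := intervalIntegral.integral_mono_on (μ := volume) hax (c4.intervalIntegrable _ _)
      ((c3.const_mul h).intervalIntegrable a (a + h)) (fun x _ => by
        have := sq_intervalIntegral_le (cy hg₂ x).norm hby
        rwa [add_sub_cancel_left] at this)
    rw [intervalIntegral.integral_const_mul, ← intervalIntegral_swap cs2 hax hby] at k2
    rw [add_sub_cancel_left] at k1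
    linarith [mul_le_mul_of_nonneg_left k2 hh.le]
  have h1 := mul_le_mul_of_nonneg_left s4 (inv_pos.2 hh).le
  have e1 : h⁻¹ * (h * (∫ x in a..a + h, ∫ y in b..b + h, ‖g₂ x y‖) ^ 2)
      = (∫ x in a..a + h, ∫ y in b..b + h, ‖g₂ x y‖) ^ 2 := by field_simp
  rw [mul_add, e1] at h1
  linarith

/-- Ladyzhenskaya's inequality before the use of Cauchy–Schwarz: bound one factor `‖g‖²` of
`‖g‖⁴` by an integral along a horizontal line and the other by one along a vertical line. -/
lemma integral_norm_pow_four_le {g g₁ g₂ : ℝ → ℝ → F} (hg : Continuous (Function.uncurry g))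
    (hg₁ : Continuous (Function.uncurry g₁)) (hg₂ : Continuous (Function.uncurry g₂))
    (hd₁ : ∀ x y, HasDerivAt (fun s => g s y) (g₁ x y) x)
    (hd₂ : ∀ x y, HasDerivAt (fun s => g x s) (g₂ x y) y) {a b : ℝ} (hab : a ≤ b)
    (h₁ : ∀ y, g a y = 0 ∧ g b y = 0) (h₂ : ∀ x, g x a = 0 ∧ g x b = 0) :
    ∫ y in a..b, ∫ x in a..b, ‖g x y‖ ^ 4
      ≤ (∫ y in a..b, ∫ x in a..b, ‖g x y‖ * ‖g₁ x y‖)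
        * ∫ y in a..b, ∫ x in a..b, ‖g x y‖ * ‖g₂ x y‖ := by
  have cx : ∀ {G : ℝ → ℝ → F}, Continuous (Function.uncurry G) → ∀ y, Continuous fun x => G x y :=
    fun hG y => hG.comp (Continuous.prodMk_left y)
  have cy : ∀ {G : ℝ → ℝ → F}, Continuous (Function.uncurry G) → ∀ x, Continuous fun y => G x y :=
    fun hG x => hG.comp (Continuous.prodMk_right x)
  have c1 : Continuous (Function.uncurry fun x y => ‖g x y‖ * ‖g₁ x y‖) := hg.norm.mul hg₁.norm
  have c2 : Continuous (Function.uncurry fun x y => ‖g x y‖ * ‖g₂ x y‖) := hg.norm.mul hg₂.norm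
  have c4 : Continuous (Function.uncurry fun x y => ‖g x y‖ ^ 4) := hg.norm.pow 4
  set A : ℝ → ℝ := fun y => ∫ x in a..b, ‖g x y‖ * ‖g₁ x y‖ with hA
  set B : ℝ → ℝ := fun x => ∫ y in a..b, ‖g x y‖ * ‖g₂ x y‖ with hB
  have cA : Continuous A := continuous_intervalIntegral_left c1 a b
  have cB : Continuous B :=
    intervalIntegral.continuous_parametric_intervalIntegral_of_continuous' c2 _ _
  have hpt : ∀ x ∈ Icc a b, ∀ y ∈ Icc a b, ‖g x y‖ ^ 4 ≤ A y * B x := by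
    intro x hx y hy
    have k1 := norm_sq_le_integral_norm_mul_norm_deriv (fun s => hd₁ s y) (cx hg₁ y) hx
      (h₁ y).1 (h₁ y).2
    have k2 := norm_sq_le_integral_norm_mul_norm_deriv (fun s => hd₂ x s) (cy hg₂ x) hy
      (h₂ x).1 (h₂ x).2
    calc ‖g x y‖ ^ 4 = ‖g x y‖ ^ 2 * ‖g x y‖ ^ 2 := by ring
      _ ≤ A y * B x := mul_le_mul k1 k2 (sq_nonneg _) ((sq_nonneg _).trans k1)
  have i1 : ∀ y ∈ Icc a b, ∫ x in a..b, ‖g x y‖ ^ 4 ≤ A y * ∫ x in a..b, B x := by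
    intro y hy
    rw [← intervalIntegral.integral_const_mul]
    exact intervalIntegral.integral_mono_on (μ := volume) hab
      (((cx hg y).norm.pow 4).intervalIntegrable _ _)
      ((cB.const_mul _).intervalIntegrable _ _) (fun x hx => hpt x hx y hy)
  have i2 := intervalIntegral.integral_mono_on (μ := volume) hab
    ((continuous_intervalIntegral_left c4 a b).intervalIntegrable _ _)
    ((cA.mul_const _).intervalIntegrable a b) i1
  rw [intervalIntegral.integral_mul_const] at i2
  rwa [intervalIntegral_swap c2 hab hab]

/-- Poincaré's inequality on the squares of an `n × n` grid, summed up. -/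
lemma integral_grid_norm_sq_le [CompleteSpace F] {g g₁ g₂ : ℝ → ℝ → F}
    (hg : Continuous (Function.uncurry g))
    (hg₁ : Continuous (Function.uncurry g₁)) (hg₂ : Continuous (Function.uncurry g₂))
    (hd₁ : ∀ x y, HasDerivAt (fun s => g s y) (g₁ x y) x)
    (hd₂ : ∀ x y, HasDerivAt (fun s => g x s) (g₂ x y) y) {a h : ℝ} (hh : 0 < h) (n : ℕ) :
    ∫ y in a..a + n * h, ∫ x in a..a + n * h, ‖g x y‖ ^ 2
      ≤ h⁻¹ ^ 2 * (∑ k ∈ Finset.range n, ∑ l ∈ Finset.range n,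
          ‖∫ y in (a + k * h)..(a + k * h) + h, ∫ x in (a + l * h)..(a + l * h) + h, g x y‖ ^ 2)
        + h ^ 2 * ((∫ y in a..a + n * h, ∫ x in a..a + n * h, ‖g₁ x y‖ ^ 2)
          + ∫ y in a..a + n * h, ∫ x in a..a + n * h, ‖g₂ x y‖ ^ 2) := by
  have split : ∀ {G : ℝ → ℝ → ℝ}, Continuous (Function.uncurry G) →
      ∫ y in a..a + n * h, ∫ x in a..a + n * h, G x y
        = ∑ k ∈ Finset.range n, ∑ l ∈ Finset.range n,
          ∫ y in (a + k * h)..(a + k * h) + h, ∫ x in (a + l * h)..(a + l * h) + h, G x y := by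
    intro G hG
    have one : ∀ {f : ℝ → ℝ}, Continuous f → ∫ x in a..a + n * h, f x
        = ∑ k ∈ Finset.range n, ∫ x in (a + k * h)..(a + k * h) + h, f x := by
      intro f hf
      have := intervalIntegral.sum_integral_adjacent_intervals (f := f) (μ := volume)
        (a := fun k : ℕ => a + k * h) (n := n) (fun k _ => hf.intervalIntegrable _ _)
      simp only [Nat.cast_zero, zero_mul, add_zero] at this
      rw [← this]
      refine Finset.sum_congr rfl fun k _ => ?_
      congr 1
      push_cast
      ring
    rw [one (continuous_intervalIntegral_left hG _ _)]
    refine Finset.sum_congr rfl fun k _ => ?_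
    rw [← intervalIntegral.integral_finsetSum]
    · congr 1
      funext y
      exact one (hG.comp (Continuous.prodMk_left y))
    · intro l _
      exact (continuous_intervalIntegral_left hG _ _).intervalIntegrable _ _
  have cs : Continuous (Function.uncurry fun x y => ‖g x y‖ ^ 2) := hg.norm.pow 2
  have cs1 : Continuous (Function.uncurry fun x y => ‖g₁ x y‖ ^ 2) := hg₁.norm.pow 2
  have cs2 : Continuous (Function.uncurry fun x y => ‖g₂ x y‖ ^ 2) := hg₂.norm.pow 2
  rw [split cs, split cs1, split cs2]
  simp only [Finset.mul_sum, ← Finset.sum_add_distrib]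
  refine Finset.sum_le_sum fun k _ => Finset.sum_le_sum fun l _ => ?_
  exact integral_square_norm_sq_le hg hg₁ hg₂ hd₁ hd₂ hh

end Plane

/-! ### Test functions on a bounded planar set -/

/-- The half-open rectangle `(a, a'] × (b, b']` in the plane. -/
def planeBox (a a' b b' : ℝ) : Set Plane := {z | z 0 ∈ Ioc a a' ∧ z 1 ∈ Ioc b b'}

lemma measurableSet_planeBox (a a' b b' : ℝ) : MeasurableSet (planeBox a a' b b') := by
  have h (i : Fin 2) : Measurable fun z : Plane => z i := by fun_prop
  exact (h 0 measurableSet_Ioc).inter (h 1 measurableSet_Ioc)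

lemma setIntegral_planeBox {E : Type*} [NormedAddCommGroup E] [NormedSpace ℝ E] {F : Plane → E}
    (hF : Continuous F) {a a' b b' : ℝ} (ha : a ≤ a') (hb : b ≤ b') :
    ∫ z in planeBox a a' b b', F z = ∫ y in b..b', ∫ x in a..a', F !₂[x, y] := by
  let e : Plane ≃ᵐ ℝ × ℝ :=
    (MeasurableEquiv.toLp 2 (Fin 2 → ℝ)).symm.trans MeasurableEquiv.finTwoArrow
  have he : MeasurePreserving e := (volume_preserving_finTwoArrow ℝ).comp
    (EuclideanSpace.volume_preserving_symm_measurableEquiv_toLp (Fin 2))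
  have hG : Continuous fun w : ℝ × ℝ => F !₂[w.1, w.2] := by fun_prop
  have h := he.setIntegral_preimage_emb e.measurableEmbedding (fun w => F !₂[w.1, w.2])
    (Ioc a a' ×ˢ Ioc b b')
  have hs : e ⁻¹' (Ioc a a' ×ˢ Ioc b b') = planeBox a a' b b' := by
    ext z
    rfl
  have hFe : ∀ z : Plane, !₂[(e z).1, (e z).2] = z := by
    intro z
    ext i
    fin_cases i <;> rfl
  simp only [hs, hFe] at h
  rw [h, Measure.volume_eq_prod, setIntegral_prod,
    intervalIntegral_swap (g := fun x y => F !₂[x, y]) hG ha hb]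
  · simp only [intervalIntegral.integral_of_le ha, intervalIntegral.integral_of_le hb]
  · exact (hG.continuousOn.integrableOn_compact (isCompact_Icc.prod isCompact_Icc)).mono_set
      (prod_mono Ioc_subset_Icc_self Ioc_subset_Icc_self)

lemma setIntegral_eq_intervalIntegral {E : Type*} [NormedAddCommGroup E] [NormedSpace ℝ E]
    {Ω : Set Plane} {R : ℝ} (hR : 0 ≤ R) (hΩ : Ω ⊆ Metric.ball 0 R) {F : Plane → E}
    (hF : Continuous F) (h0 : ∀ z ∉ Ω, F z = 0) :
    ∫ z in Ω, F z = ∫ y in (-R)..R, ∫ x in (-R)..R, F !₂[x, y] := by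
  rw [← setIntegral_planeBox hF (by linarith) (by linarith),
    setIntegral_eq_integral_of_forall_compl_eq_zero h0,
    setIntegral_eq_integral_of_forall_compl_eq_zero]
  intro z hz
  refine h0 z fun hzΩ => hz ?_
  have h1 := mem_ball_zero_iff.1 (hΩ hzΩ)
  have h2 := abs_lt.1 ((PiLp.norm_apply_le z 0).trans_lt h1)
  have h3 := abs_lt.1 ((PiLp.norm_apply_le z 1).trans_lt h1)
  exact ⟨⟨h2.1, h2.2.le⟩, h3.1, h3.2.le⟩

lemma norm_sq_eq_integral {α E : Type*} [MeasurableSpace α] {μ : Measure α}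
    [NormedAddCommGroup E] [InnerProductSpace ℝ E] (f : Lp E 2 μ) :
    ‖f‖ ^ 2 = ∫ x, ‖f x‖ ^ 2 ∂μ := by
  rw [← real_inner_self_eq_norm_sq, L2.inner_def]
  simp only [real_inner_self_eq_norm_sq]

section Test

variable {φ : Plane → Plane}

lemma continuous_partial (hφ : ContDiff ℝ ∞ φ) (v : Plane) :
    Continuous fun z => fderiv ℝ φ z v :=
  (hφ.continuous_fderiv (by simp)).clm_apply continuous_const

lemma classicalGrad_apply (φ : Plane → Plane) (z : Plane) (i : Fin 2) :
    classicalGrad φ z i = fderiv ℝ φ z (EuclideanSpace.single i 1) := rfl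

lemma continuous_classicalGrad (hφ : ContDiff ℝ ∞ φ) : Continuous (classicalGrad φ) := by
  have := fun i : Fin 2 => continuous_partial hφ (EuclideanSpace.single i 1)
  unfold classicalGrad
  fun_prop

lemma classicalGrad_eq_zero {z : Plane} (hz : z ∉ tsupport φ) : classicalGrad φ z = 0 := by
  have : fderiv ℝ φ z = 0 := by
    by_contra h
    exact hz (support_fderiv_subset ℝ h)
  ext i
  simp [classicalGrad, this]

lemma norm_classicalGrad_sq (φ : Plane → Plane) (z : Plane) :
    ‖classicalGrad φ z‖ ^ 2 = ‖fderiv ℝ φ z (EuclideanSpace.single 0 1)‖ ^ 2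
      + ‖fderiv ℝ φ z (EuclideanSpace.single 1 1)‖ ^ 2 := by
  rw [PiLp.norm_sq_eq_of_L2, Fin.sum_univ_two]
  rfl

lemma hasDerivAt_first (hφ : ContDiff ℝ ∞ φ) (x y : ℝ) :
    HasDerivAt (fun s => φ !₂[s, y]) (fderiv ℝ φ !₂[x, y] (EuclideanSpace.single 0 1)) x := by
  have h1 : HasDerivAt (fun s : ℝ => (!₂[s, y] : Plane)) (EuclideanSpace.single 0 1) x := by
    have e : (fun s : ℝ => (!₂[s, y] : Plane))
        = fun s => s • EuclideanSpace.single 0 1 + y • EuclideanSpace.single 1 1 := by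
      funext s
      ext i
      fin_cases i <;> simp
    rw [e]
    simpa using ((hasDerivAt_id x).smul_const (EuclideanSpace.single (0 : Fin 2) (1 : ℝ))).add_const
      (y • EuclideanSpace.single (1 : Fin 2) (1 : ℝ))
  exact ((hφ.differentiable (by simp) _).hasFDerivAt).comp_hasDerivAt x h1

lemma hasDerivAt_second (hφ : ContDiff ℝ ∞ φ) (x y : ℝ) :
    HasDerivAt (fun s => φ !₂[x, s]) (fderiv ℝ φ !₂[x, y] (EuclideanSpace.single 1 1)) y := by
  have h1 : HasDerivAt (fun s : ℝ => (!₂[x, s] : Plane)) (EuclideanSpace.single 1 1) y := by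
    have e : (fun s : ℝ => (!₂[x, s] : Plane))
        = fun s => s • EuclideanSpace.single 1 1 + x • EuclideanSpace.single 0 1 := by
      funext s
      ext i
      fin_cases i <;> simp
    rw [e]
    simpa using ((hasDerivAt_id y).smul_const (EuclideanSpace.single (1 : Fin 2) (1 : ℝ))).add_const
      (x • EuclideanSpace.single (0 : Fin 2) (1 : ℝ))
  exact ((hφ.differentiable (by simp) _).hasFDerivAt).comp_hasDerivAt y h1

lemma continuous_uncurry_plane {E : Type*} [TopologicalSpace E] {F : Plane → E}
    (hF : Continuous F) : Continuous (Function.uncurry fun x y : ℝ => F !₂[x, y]) := by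
  have : Continuous fun w : ℝ × ℝ => (!₂[w.1, w.2] : Plane) := by fun_prop
  exact hF.comp this

/-- Ladyzhenskaya's inequality for test functions, with the constant `1/2`. -/
lemma ladyzhenskaya_test {Ω : Set Plane} (hΩ : Bornology.IsBounded Ω) (hφ : ContDiff ℝ ∞ φ)
    (hc : HasCompactSupport φ) (hs : tsupport φ ⊆ Ω) :
    ∫ z in Ω, ‖φ z‖ ^ 4
      ≤ 1 / 2 * (∫ z in Ω, ‖φ z‖ ^ 2) * ∫ z in Ω, ‖classicalGrad φ z‖ ^ 2 := by
  obtain ⟨R, hR, hΩR⟩ : ∃ R, 0 < R ∧ Ω ⊆ Metric.ball 0 R := by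
    obtain ⟨R, hR⟩ := hΩ.subset_ball 0
    exact ⟨max R 1, by positivity, hR.trans (Metric.ball_subset_ball (le_max_left _ _))⟩
  have h0 : ∀ z ∉ Ω, φ z = 0 := fun z hz => image_eq_zero_of_notMem_tsupport fun h => hz (hs h)
  have hout : ∀ z : Plane, ∀ i, R ≤ |z i| → φ z = 0 := by
    intro z i hz
    refine h0 z fun h => ?_
    have := (PiLp.norm_apply_le z i).trans_lt (mem_ball_zero_iff.1 (hΩR h))
    rw [Real.norm_eq_abs] at this
    linarith
  have cφ := hφ.continuous
  have c1 := continuous_partial hφ (EuclideanSpace.single 0 1)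
  have c2 := continuous_partial hφ (EuclideanSpace.single 1 1)
  have key := integral_norm_pow_four_le (continuous_uncurry_plane cφ)
    (continuous_uncurry_plane c1) (continuous_uncurry_plane c2)
    (hasDerivAt_first hφ) (hasDerivAt_second hφ) (a := -R) (b := R) (by linarith)
    (fun y => ⟨hout _ 0 (by simp [abs_of_pos hR]), hout _ 0 (by simp [abs_of_pos hR])⟩)
    (fun x => ⟨hout _ 1 (by simp [abs_of_pos hR]), hout _ 1 (by simp [abs_of_pos hR])⟩)
  rw [← setIntegral_eq_intervalIntegral hR.le hΩR (F := fun z => ‖φ z‖ ^ 4) (by fun_prop)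
      (fun z hz => by simp [h0 z hz]),
    ← setIntegral_eq_intervalIntegral hR.le hΩR
      (F := fun z => ‖φ z‖ * ‖fderiv ℝ φ z (EuclideanSpace.single 0 1)‖) (by fun_prop)
      (fun z hz => by simp [h0 z hz]),
    ← setIntegral_eq_intervalIntegral hR.le hΩR
      (F := fun z => ‖φ z‖ * ‖fderiv ℝ φ z (EuclideanSpace.single 1 1)‖) (by fun_prop)
      (fun z hz => by simp [h0 z hz])] at key
  have m0 : MemLp (fun z => ‖φ z‖) 2 (volume.restrict Ω) :=
    ((cφ.memLp_of_hasCompactSupport hc).restrict Ω).norm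
  have mi : ∀ v, MemLp (fun z => ‖fderiv ℝ φ z v‖) 2 (volume.restrict Ω) := fun v =>
    (((continuous_partial hφ v).memLp_of_hasCompactSupport (hc.fderiv_apply ℝ v)).restrict Ω).norm
  have k1 := sq_integral_mul_le m0 (mi (EuclideanSpace.single 0 1))
  have k2 := sq_integral_mul_le m0 (mi (EuclideanSpace.single 1 1))
  simp only [norm_classicalGrad_sq]
  rw [integral_add (mi _).integrable_sq (mi _).integrable_sq]
  have n1 : 0 ≤ ∫ z in Ω, ‖fderiv ℝ φ z (EuclideanSpace.single 0 1)‖ ^ 2 :=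
    integral_nonneg fun _ => sq_nonneg _
  have n2 : 0 ≤ ∫ z in Ω, ‖fderiv ℝ φ z (EuclideanSpace.single 1 1)‖ ^ 2 :=
    integral_nonneg fun _ => sq_nonneg _
  have n0 : 0 ≤ ∫ z in Ω, ‖φ z‖ ^ 2 := integral_nonneg fun _ => sq_nonneg _
  refine key.trans ?_
  generalize (∫ z in Ω, ‖φ z‖ ^ 2) = N at *
  generalize (∫ z in Ω, ‖fderiv ℝ φ z (EuclideanSpace.single 0 1)‖ ^ 2) = D1 at *
  generalize (∫ z in Ω, ‖fderiv ℝ φ z (EuclideanSpace.single 1 1)‖ ^ 2) = D2 at *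
  generalize (∫ z in Ω, ‖φ z‖ * ‖fderiv ℝ φ z (EuclideanSpace.single 0 1)‖) = X at *
  generalize (∫ z in Ω, ‖φ z‖ * ‖fderiv ℝ φ z (EuclideanSpace.single 1 1)‖) = Y at *
  refine le_of_sq_le_sq (?_ : (X * Y) ^ 2 ≤ (1 / 2 * N * (D1 + D2)) ^ 2) (by positivity)
  calc (X * Y) ^ 2 = X ^ 2 * Y ^ 2 := by ring
    _ ≤ (N * D1) * (N * D2) := by gcongr
    _ ≤ (1 / 2 * N * (D1 + D2)) ^ 2 := by
      linarith [mul_nonneg (sq_nonneg N) (sq_nonneg (D1 - D2))]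

/-- A Friedrichs-type inequality for test functions: the averages over the squares of a fine grid
control the `L²`-norm up to a small multiple of the gradient. -/
lemma friedrichs_test {Ω : Set Plane} {R : ℝ} (hR : 0 < R) (hΩR : Ω ⊆ Metric.ball 0 R)
    (hφ : ContDiff ℝ ∞ φ) (hc : HasCompactSupport φ) (hs : tsupport φ ⊆ Ω) {n : ℕ} (hn : 0 < n) :
    ∫ z in Ω, ‖φ z‖ ^ 2 ≤ (2 * R / n)⁻¹ ^ 2 * (∑ k ∈ Finset.range n, ∑ l ∈ Finset.range n,
        ‖∫ z in planeBox (-R + l * (2 * R / n)) (-R + l * (2 * R / n) + 2 * R / n)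
          (-R + k * (2 * R / n)) (-R + k * (2 * R / n) + 2 * R / n), φ z‖ ^ 2)
      + (2 * R / n) ^ 2 * ∫ z in Ω, ‖classicalGrad φ z‖ ^ 2 := by
  have h0 : ∀ z ∉ Ω, φ z = 0 := fun z hz => image_eq_zero_of_notMem_tsupport fun h => hz (hs h)
  have h0' : ∀ v, ∀ z ∉ Ω, fderiv ℝ φ z v = 0 := fun v z hz => by
    have : fderiv ℝ φ z = 0 := by
      by_contra h
      exact hz (hs (support_fderiv_subset ℝ h))
    simp [this]
  have hn' : (0 : ℝ) < n := by exact_mod_cast hn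
  have hh : 0 < 2 * R / n := by positivity
  have cφ := hφ.continuous
  have c1 := continuous_partial hφ (EuclideanSpace.single 0 1)
  have c2 := continuous_partial hφ (EuclideanSpace.single 1 1)
  have key := integral_grid_norm_sq_le (continuous_uncurry_plane cφ)
    (continuous_uncurry_plane c1) (continuous_uncurry_plane c2)
    (hasDerivAt_first hφ) (hasDerivAt_second hφ) (a := -R) hh n
  have e : -R + n * (2 * R / n) = R := by field_simp; ring
  rw [e, ← setIntegral_eq_intervalIntegral hR.le hΩR (F := fun z => ‖φ z‖ ^ 2) (by fun_prop)
      (fun z hz => by simp [h0 z hz]),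
    ← setIntegral_eq_intervalIntegral hR.le hΩR
      (F := fun z => ‖fderiv ℝ φ z (EuclideanSpace.single 0 1)‖ ^ 2) (by fun_prop)
      (fun z hz => by simp [h0' _ z hz]),
    ← setIntegral_eq_intervalIntegral hR.le hΩR
      (F := fun z => ‖fderiv ℝ φ z (EuclideanSpace.single 1 1)‖ ^ 2) (by fun_prop)
      (fun z hz => by simp [h0' _ z hz])] at key
  have mi : ∀ v, MemLp (fun z => ‖fderiv ℝ φ z v‖) 2 (volume.restrict Ω) := fun v =>
    (((continuous_partial hφ v).memLp_of_hasCompactSupport (hc.fderiv_apply ℝ v)).restrict Ω).norm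
  simp only [norm_classicalGrad_sq]
  rw [integral_add (mi _).integrable_sq (mi _).integrable_sq]
  simpa only [setIntegral_planeBox cφ (le_add_of_nonneg_right hh.le)
    (le_add_of_nonneg_right hh.le)] using key

end Test

/-! ### Ladyzhenskaya's inequality in `H₀¹` -/

open Filter Topology in
lemma exists_test_seq {Ω : Set Plane} {p : L2 Ω × L2Grad Ω} (hp : p ∈ H10 Ω) :
    ∃ q : ℕ → L2 Ω × L2Grad Ω, (∀ n, q n ∈ testGraph Ω) ∧ Tendsto q atTop (𝓝 p) :=
  mem_closure_iff_seq_limit.1 hp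

lemma norm_fst_sq_of_ae {Ω : Set Plane} {p : L2 Ω × L2Grad Ω} {φ : Plane → Plane}
    (h : p.1 =ᵐ[volume.restrict Ω] φ) : ‖p.1‖ ^ 2 = ∫ z in Ω, ‖φ z‖ ^ 2 := by
  rw [norm_sq_eq_integral]
  exact integral_congr_ae (h.mono fun z hz => by simp [hz])

lemma norm_snd_sq_of_ae {Ω : Set Plane} {p : L2 Ω × L2Grad Ω} {g : Plane → GradVal}
    (h : p.2 =ᵐ[volume.restrict Ω] g) : ‖p.2‖ ^ 2 = ∫ z in Ω, ‖g z‖ ^ 2 := by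
  rw [norm_sq_eq_integral]
  exact integral_congr_ae (h.mono fun z hz => by simp [hz])

open Filter Topology in
/-- Ladyzhenskaya's inequality, by density of the test functions and Fatou's lemma. -/
lemma lintegral_pow_four_le {Ω : Set Plane} (hΩ : Bornology.IsBounded Ω) {p : L2 Ω × L2Grad Ω}
    (hp : p ∈ H10 Ω) :
    ∫⁻ x in Ω, ‖p.1 x‖ₑ ^ 4 ≤ ENNReal.ofReal (1 / 2 * ‖p.1‖ ^ 2 * ‖p.2‖ ^ 2) := by
  have htest : ∀ q ∈ testGraph Ω,
      ∫⁻ x in Ω, ‖q.1 x‖ₑ ^ 4 ≤ ENNReal.ofReal (1 / 2 * ‖q.1‖ ^ 2 * ‖q.2‖ ^ 2) := by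
    rintro q ⟨φ, hφ, hc, hs, h1, h2⟩
    rw [norm_fst_sq_of_ae h1, norm_snd_sq_of_ae h2]
    refine le_trans (le_of_eq ?_) (ENNReal.ofReal_le_ofReal (ladyzhenskaya_test hΩ hφ hc hs))
    have hi : Integrable (fun z => ‖φ z‖ ^ 4) (volume.restrict Ω) := by
      have : Continuous fun z => ‖φ z‖ ^ 4 := by have := hφ.continuous; fun_prop
      refine (this.integrable_of_hasCompactSupport ?_).restrict
      exact hc.comp_left (g := fun v => ‖v‖ ^ 4) (by simp)
    rw [ofReal_integral_eq_lintegral_ofReal hi (.of_forall fun _ => by positivity)]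
    refine lintegral_congr_ae (h1.mono fun z hz => ?_)
    simp only [hz]
    rw [ENNReal.ofReal_pow (norm_nonneg _), ofReal_norm]
  obtain ⟨q, hq, hqp⟩ := exists_test_seq hp
  have hq1 : Tendsto (fun n => (q n).1) atTop (𝓝 p.1) := (continuous_fst.tendsto p).comp hqp
  obtain ⟨ns, hns, hae⟩ := (tendstoInMeasure_of_tendsto_Lp hq1).exists_seq_tendsto_ae
  have hlim : Tendsto (fun n => ENNReal.ofReal (1 / 2 * ‖(q (ns n)).1‖ ^ 2 * ‖(q (ns n)).2‖ ^ 2))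
      atTop (𝓝 (ENNReal.ofReal (1 / 2 * ‖p.1‖ ^ 2 * ‖p.2‖ ^ 2))) := by
    have hc : Continuous fun r : L2 Ω × L2Grad Ω =>
        ENNReal.ofReal (1 / 2 * ‖r.1‖ ^ 2 * ‖r.2‖ ^ 2) :=
      ENNReal.continuous_ofReal.comp (by fun_prop)
    exact (hc.tendsto p).comp (hqp.comp hns.tendsto_atTop)
  calc ∫⁻ x in Ω, ‖p.1 x‖ₑ ^ 4
      = ∫⁻ x in Ω, liminf (fun n => ‖(q (ns n)).1 x‖ₑ ^ 4) atTop := by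
        refine lintegral_congr_ae (hae.mono fun x hx => ?_)
        exact (((ENNReal.continuous_pow 4).tendsto _).comp hx.enorm).liminf_eq.symm
    _ ≤ liminf (fun n => ∫⁻ x in Ω, ‖(q (ns n)).1 x‖ₑ ^ 4) atTop :=
        lintegral_liminf_le' fun n => (Lp.aestronglyMeasurable _).enorm.pow_const 4
    _ ≤ liminf (fun n => ENNReal.ofReal (1 / 2 * ‖(q (ns n)).1‖ ^ 2 * ‖(q (ns n)).2‖ ^ 2)) atTop :=
        liminf_le_liminf (.of_forall fun n => htest _ (hq _))
    _ = _ := hlim.liminf_eq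

lemma memLp_norm_sq {Ω : Set Plane} (hΩ : Bornology.IsBounded Ω) {p : L2 Ω × L2Grad Ω}
    (hp : p ∈ H10 Ω) : MemLp (fun x => ‖p.1 x‖ ^ 2) 2 (volume.restrict Ω) := by
  have hm : AEStronglyMeasurable (fun x => ‖p.1 x‖ ^ 2) (volume.restrict Ω) :=
    (Lp.aestronglyMeasurable p.1).norm.pow 2
  rw [memLp_two_iff_integrable_sq hm]
  refine ⟨hm.pow 2, ?_⟩
  refine lt_of_le_of_lt (le_of_eq ?_) ((lintegral_pow_four_le hΩ hp).trans_lt ENNReal.ofReal_lt_top)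
  refine lintegral_congr fun x => ?_
  rw [enorm_pow, enorm_pow, enorm_norm, ← pow_mul]

lemma integral_norm_pow_four_le_of_mem {Ω : Set Plane} (hΩ : Bornology.IsBounded Ω)
    {p : L2 Ω × L2Grad Ω} (hp : p ∈ H10 Ω) :
    ∫ x in Ω, (‖p.1 x‖ ^ 2) ^ 2 ≤ 1 / 2 * ‖p.1‖ ^ 2 * ‖p.2‖ ^ 2 := by
  have hm : AEStronglyMeasurable (fun x => ‖p.1 x‖ ^ 2) (volume.restrict Ω) :=
    (Lp.aestronglyMeasurable p.1).norm.pow 2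
  have hm2 : AEStronglyMeasurable (fun x => (‖p.1 x‖ ^ 2) ^ 2) (volume.restrict Ω) := hm.pow 2
  rw [integral_eq_lintegral_of_nonneg_ae (.of_forall fun _ => by positivity) hm2]
  refine ENNReal.toReal_le_of_le_ofReal (by positivity) ?_
  refine le_trans (le_of_eq ?_) (lintegral_pow_four_le hΩ hp)
  refine lintegral_congr fun x => ?_
  rw [← ofReal_norm, ← ENNReal.ofReal_pow (norm_nonneg _), ← pow_mul]

/-! ### The trilinear form -/

/-- The form `∫_Ω ∑ᵢ uᵢ gᵢ · w dx`, with an arbitrary field `g` in the place of a gradient. -/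
noncomputable def advection {Ω : Set Plane} (u : L2 Ω) (g : L2Grad Ω) (w : L2 Ω) : ℝ :=
  ∫ x in Ω, ∑ i, (u x) i * inner ℝ (g x i) (w x)

lemma abs_sum_mul_inner_le (u w : Plane) (g : GradVal) :
    |∑ i, u i * inner ℝ (g i) w| ≤ ‖g‖ * (‖u‖ * ‖w‖) := by
  have h1 : ‖∑ i, u i • g i‖ ≤ ‖u‖ * ‖g‖ := by
    calc ‖∑ i, u i • g i‖ ≤ ∑ i, ‖u i‖ * ‖g i‖ := by
          refine (norm_sum_le _ _).trans_eq ?_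
          simp only [norm_smul]
      _ ≤ √(∑ i, ‖u i‖ ^ 2) * √(∑ i, ‖g i‖ ^ 2) := Real.sum_mul_le_sqrt_mul_sqrt _ _ _
      _ = ‖u‖ * ‖g‖ := by rw [PiLp.norm_eq_of_L2, PiLp.norm_eq_of_L2]
  have h2 : ∑ i, u i * inner ℝ (g i) w = inner ℝ (∑ i, u i • g i) w := by
    rw [sum_inner]
    simp only [real_inner_smul_left]
  rw [h2]
  calc |inner ℝ (∑ i, u i • g i) w| ≤ ‖∑ i, u i • g i‖ * ‖w‖ := abs_real_inner_le_norm _ _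
    _ ≤ ‖u‖ * ‖g‖ * ‖w‖ := by gcongr
    _ = _ := by ring

section Advection

variable {Ω : Set Plane}

lemma memLp_norm_mul_norm (hΩ : Bornology.IsBounded Ω) {p r : L2 Ω × L2Grad Ω} (hp : p ∈ H10 Ω)
    (hr : r ∈ H10 Ω) : MemLp (fun x => ‖p.1 x‖ * ‖r.1 x‖) 2 (volume.restrict Ω) := by
  have hm : AEStronglyMeasurable (fun x => ‖p.1 x‖ * ‖r.1 x‖) (volume.restrict Ω) :=
    (Lp.aestronglyMeasurable p.1).norm.mul (Lp.aestronglyMeasurable r.1).norm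
  rw [memLp_two_iff_integrable_sq hm]
  refine ((memLp_norm_sq hΩ hp).integrable_mul (memLp_norm_sq hΩ hr)).congr (.of_forall fun x => ?_)
  simp only [Pi.mul_apply]
  ring

lemma aestronglyMeasurable_advection (u : L2 Ω) (g : L2Grad Ω) (w : L2 Ω) :
    AEStronglyMeasurable (fun x => ∑ i, (u x) i * inner ℝ (g x i) (w x)) (volume.restrict Ω) := by
  have hu := Lp.aestronglyMeasurable u
  have hg := Lp.aestronglyMeasurable g
  have hw := Lp.aestronglyMeasurable w
  refine Finset.aestronglyMeasurable_fun_sum _ fun i _ => ?_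
  have h1 : AEStronglyMeasurable (fun x => (u x) i) (volume.restrict Ω) :=
    (by fun_prop : Continuous fun v : Plane => v i).comp_aestronglyMeasurable hu
  have h2 : AEStronglyMeasurable (fun x => g x i) (volume.restrict Ω) :=
    (by fun_prop : Continuous fun v : GradVal => v i).comp_aestronglyMeasurable hg
  exact h1.mul (h2.inner hw)

lemma integrable_advection (hΩ : Bornology.IsBounded Ω) {p r : L2 Ω × L2Grad Ω} (hp : p ∈ H10 Ω)
    (g : L2Grad Ω) (hr : r ∈ H10 Ω) :
    Integrable (fun x => ∑ i, (p.1 x) i * inner ℝ (g x i) (r.1 x)) (volume.restrict Ω) :=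
  ((Lp.memLp g).norm.integrable_mul (memLp_norm_mul_norm hΩ hp hr)).mono'
    (aestronglyMeasurable_advection _ _ _) (.of_forall fun _ => abs_sum_mul_inner_le _ _ _)

lemma advection_sq_le (hΩ : Bornology.IsBounded Ω) {p r : L2 Ω × L2Grad Ω} (hp : p ∈ H10 Ω)
    (g : L2Grad Ω) (hr : r ∈ H10 Ω) :
    advection p.1 g r.1 ^ 2 ≤ 1 / 2 * ‖g‖ ^ 2 * (‖p.1‖ * ‖p.2‖ * (‖r.1‖ * ‖r.2‖)) := by
  have hm := memLp_norm_mul_norm hΩ hp hr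
  have h1 : |advection p.1 g r.1| ≤ ∫ x in Ω, ‖g x‖ * (‖p.1 x‖ * ‖r.1 x‖) := by
    refine (norm_integral_le_integral_norm (G := ℝ) _).trans ?_
    exact integral_mono (integrable_advection hΩ hp g hr).norm
      ((Lp.memLp g).norm.integrable_mul hm) fun _ => abs_sum_mul_inner_le _ _ _
  have h2 := sq_integral_mul_le (f := fun x => ‖g x‖) (Lp.memLp g).norm hm
  rw [← norm_sq_eq_integral] at h2
  have h3 := sq_integral_mul_le (memLp_norm_sq hΩ hp) (memLp_norm_sq hΩ hr)
  have h4 : ∫ x in Ω, (‖p.1 x‖ * ‖r.1 x‖) ^ 2 = ∫ x in Ω, ‖p.1 x‖ ^ 2 * ‖r.1 x‖ ^ 2 := by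
    simp only [mul_pow]
  have h5 : ∫ x in Ω, ‖p.1 x‖ ^ 2 * ‖r.1 x‖ ^ 2 ≤ 1 / 2 * (‖p.1‖ * ‖p.2‖ * (‖r.1‖ * ‖r.2‖)) := by
    refine le_of_sq_le_sq (h3.trans ?_) (by positivity)
    calc _ ≤ (1 / 2 * ‖p.1‖ ^ 2 * ‖p.2‖ ^ 2) * (1 / 2 * ‖r.1‖ ^ 2 * ‖r.2‖ ^ 2) :=
          mul_le_mul (integral_norm_pow_four_le_of_mem hΩ hp)
            (integral_norm_pow_four_le_of_mem hΩ hr)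
            (integral_nonneg fun _ => by positivity) (by positivity)
      _ = _ := by ring
  rw [h4] at h2
  calc advection p.1 g r.1 ^ 2 = |advection p.1 g r.1| ^ 2 := (sq_abs _).symm
    _ ≤ (∫ x in Ω, ‖g x‖ * (‖p.1 x‖ * ‖r.1 x‖)) ^ 2 := by gcongr
    _ ≤ ‖g‖ ^ 2 * (1 / 2 * (‖p.1‖ * ‖p.2‖ * (‖r.1‖ * ‖r.2‖))) :=
        h2.trans (by gcongr)
    _ = _ := by ring

lemma advection_add_middle (hΩ : Bornology.IsBounded Ω) {p r : L2 Ω × L2Grad Ω} (hp : p ∈ H10 Ω)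
    (g g' : L2Grad Ω) (hr : r ∈ H10 Ω) :
    advection p.1 (g + g') r.1 = advection p.1 g r.1 + advection p.1 g' r.1 := by
  unfold advection
  rw [← integral_add (integrable_advection hΩ hp g hr) (integrable_advection hΩ hp g' hr)]
  refine integral_congr_ae ((Lp.coeFn_add g g').mono fun x hx => ?_)
  simp only [hx, Pi.add_apply, PiLp.add_apply, inner_add_left, mul_add, Finset.sum_add_distrib]

lemma advection_smul_middle (c : ℝ) (u : L2 Ω) (g : L2Grad Ω) (w : L2 Ω) :
    advection u (c • g) w = c * advection u g w := by
  unfold advection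
  rw [← integral_const_mul]
  refine integral_congr_ae ((Lp.coeFn_smul c g).mono fun x hx => ?_)
  simp only [hx, Pi.smul_apply, PiLp.smul_apply, real_inner_smul_left, Finset.mul_sum]
  exact Finset.sum_congr rfl fun i _ => by ring

lemma advection_add_right (hΩ : Bornology.IsBounded Ω) {p r r' : L2 Ω × L2Grad Ω} (hp : p ∈ H10 Ω)
    (g : L2Grad Ω) (hr : r ∈ H10 Ω) (hr' : r' ∈ H10 Ω) :
    advection p.1 g (r.1 + r'.1) = advection p.1 g r.1 + advection p.1 g r'.1 := by
  unfold advection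
  rw [← integral_add (integrable_advection hΩ hp g hr) (integrable_advection hΩ hp g hr')]
  refine integral_congr_ae ((Lp.coeFn_add r.1 r'.1).mono fun x hx => ?_)
  simp only [hx, Pi.add_apply, inner_add_right, mul_add, Finset.sum_add_distrib]

lemma integral_mul_fderiv_eq_neg {f g : Plane → ℝ} (hf : ContDiff ℝ ∞ f) (hg : ContDiff ℝ ∞ g)
    (hfc : HasCompactSupport f) (v : Plane) :
    ∫ x, f x * fderiv ℝ g x v = -∫ x, fderiv ℝ f x v * g x := by
  have cf : Continuous fun x => fderiv ℝ f x v :=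
    (hf.continuous_fderiv (by simp)).clm_apply continuous_const
  have cg : Continuous fun x => fderiv ℝ g x v :=
    (hg.continuous_fderiv (by simp)).clm_apply continuous_const
  exact integral_mul_fderiv_eq_neg_fderiv_mul_of_integrable
    ((cf.mul hg.continuous).integrable_of_hasCompactSupport (hfc.fderiv_apply ℝ v).mul_right)
    ((hf.continuous.mul cg).integrable_of_hasCompactSupport hfc.mul_right)
    ((hf.continuous.mul hg.continuous).integrable_of_hasCompactSupport hfc.mul_right)
    (fun x _ => hf.differentiable (by simp) x) (fun x _ => hg.differentiable (by simp) x)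

/-- Integration by parts for two test functions. -/
lemma integral_advection_test {φ ψ : Plane → Plane} (hφ : ContDiff ℝ ∞ φ) (hψ : ContDiff ℝ ∞ ψ)
    (hψc : HasCompactSupport ψ) :
    ∫ x, ∑ i, (ψ x) i * inner ℝ (classicalGrad φ x i) (φ x)
      = -∫ x, 1 / 2 * ‖φ x‖ ^ 2 * ∑ i, (classicalGrad ψ x i) i := by
  have cφ := hφ.continuous
  have cg := continuous_classicalGrad hφ
  have hψi (i : Fin 2) : ContDiff ℝ ∞ fun x => ψ x i :=
    (EuclideanSpace.proj i : Plane →L[ℝ] ℝ).contDiff.comp hψ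
  have hq : ContDiff ℝ ∞ fun x => 1 / 2 * ‖φ x‖ ^ 2 := contDiff_const.mul (hφ.norm_sq ℝ)
  have g1 (i : Fin 2) (x : Plane) : fderiv ℝ (fun x => ψ x i) x (EuclideanSpace.single i 1)
      = (classicalGrad ψ x i) i := by
    have h : HasFDerivAt (fun x => ψ x i)
        ((EuclideanSpace.proj i : Plane →L[ℝ] ℝ).comp (fderiv ℝ ψ x)) x :=
      (EuclideanSpace.proj i : Plane →L[ℝ] ℝ).hasFDerivAt.comp x
        (hψ.differentiable (by simp) x).hasFDerivAt
    rw [h.fderiv]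
    rfl
  have g2 (i : Fin 2) (x : Plane) :
      fderiv ℝ (fun x => 1 / 2 * ‖φ x‖ ^ 2) x (EuclideanSpace.single i 1)
      = inner ℝ (classicalGrad φ x i) (φ x) := by
    have h := ((hφ.differentiable (by simp) x).hasFDerivAt.norm_sq).const_mul (1 / 2 : ℝ)
    rw [h.fderiv, real_inner_comm, classicalGrad_apply]
    simp
  have hparts (i : Fin 2) : ∫ x, ψ x i * inner ℝ (classicalGrad φ x i) (φ x)
      = -∫ x, 1 / 2 * ‖φ x‖ ^ 2 * (classicalGrad ψ x i) i := by
    have hci : HasCompactSupport fun x => ψ x i := hψc.comp_left (g := fun v : Plane => v i) rfl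
    have := integral_mul_fderiv_eq_neg (hψi i) hq hci (EuclideanSpace.single i 1)
    simp only [g1, g2] at this
    rw [this]
    congr 1
    exact integral_congr_ae (.of_forall fun x => mul_comm _ _)
  simp only [Finset.mul_sum]
  rw [integral_finsetSum, integral_finsetSum, ← Finset.sum_neg_distrib]
  · exact Finset.sum_congr rfl fun i _ => hparts i
  · intro i _
    have c2 : Continuous fun x => (classicalGrad ψ x i) i :=
      (by fun_prop : Continuous fun v : GradVal => v i i).comp (continuous_classicalGrad hψ)
    refine (hq.continuous.mul c2).integrable_of_hasCompactSupport ?_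
    exact HasCompactSupport.intro hψc fun x hx => by simp [classicalGrad_eq_zero hx]
  · intro i _
    have c1 : Continuous fun x => classicalGrad φ x i :=
      (by fun_prop : Continuous fun v : GradVal => v i).comp cg
    refine ((hψi i).continuous.mul (c1.inner cφ)).integrable_of_hasCompactSupport ?_
    exact HasCompactSupport.intro hψc fun x hx => by simp [image_eq_zero_of_notMem_tsupport hx]

/-- Integration by parts against a fixed test function. -/
lemma advection_test {p q : L2 Ω × L2Grad Ω} (hp : p ∈ H10 Ω) {φ : Plane → Plane}
    (hφ : ContDiff ℝ ∞ φ) (hc : HasCompactSupport φ)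
    (h1 : q.1 =ᵐ[volume.restrict Ω] φ) (h2 : q.2 =ᵐ[volume.restrict Ω] classicalGrad φ) :
    advection p.1 q.2 q.1 = -∫ x in Ω, 1 / 2 * ‖φ x‖ ^ 2 * ∑ i, (p.2 x i) i := by
  have cφ := hφ.continuous
  have cg := continuous_classicalGrad hφ
  -- both sides are continuous linear in `p`: they are inner products with two fixed fields
  let G₁ : Plane → Plane := fun x => WithLp.toLp 2 fun i => inner ℝ (classicalGrad φ x i) (φ x)
  let G₂ : Plane → GradVal := fun x =>
    WithLp.toLp 2 fun i => (1 / 2 * ‖φ x‖ ^ 2) • EuclideanSpace.single i 1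
  have cG₁ : Continuous G₁ := by
    have (i : Fin 2) : Continuous fun x => classicalGrad φ x i :=
      (by fun_prop : Continuous fun v : GradVal => v i).comp cg
    fun_prop
  have cG₂ : Continuous G₂ := by fun_prop
  have sG₁ : HasCompactSupport G₁ := by
    refine HasCompactSupport.intro hc fun x hx => ?_
    ext i
    simp [G₁, image_eq_zero_of_notMem_tsupport hx]
  have sG₂ : HasCompactSupport G₂ := by
    refine HasCompactSupport.intro hc fun x hx => ?_
    ext i
    simp [G₂, image_eq_zero_of_notMem_tsupport hx]
  have m₁ : MemLp G₁ 2 (volume.restrict Ω) := (cG₁.memLp_of_hasCompactSupport sG₁).restrict Ω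
  have m₂ : MemLp G₂ 2 (volume.restrict Ω) := (cG₂.memLp_of_hasCompactSupport sG₂).restrict Ω
  have e1 : ∀ p : L2 Ω × L2Grad Ω, inner ℝ m₁.toLp p.1
      = ∫ x in Ω, ∑ i, (p.1 x) i * inner ℝ (classicalGrad φ x i) (φ x) := by
    intro p
    rw [L2.inner_def]
    refine integral_congr_ae (m₁.coeFn_toLp.mono fun x hx => ?_)
    change inner ℝ (MemLp.toLp G₁ m₁ x) (p.1 x) = _
    rw [hx, PiLp.inner_apply]
    rfl
  have e2 : ∀ p : L2 Ω × L2Grad Ω, inner ℝ m₂.toLp p.2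
      = ∫ x in Ω, 1 / 2 * ‖φ x‖ ^ 2 * ∑ i, (p.2 x i) i := by
    intro p
    rw [L2.inner_def]
    refine integral_congr_ae (m₂.coeFn_toLp.mono fun x hx => ?_)
    change inner ℝ (MemLp.toLp G₂ m₂ x) (p.2 x) = 1 / 2 * ‖φ x‖ ^ 2 * ∑ i, (p.2 x i) i
    rw [hx, PiLp.inner_apply, Finset.mul_sum]
    refine Finset.sum_congr rfl fun i _ => ?_
    change inner ℝ ((1 / 2 * ‖φ x‖ ^ 2) • EuclideanSpace.single i (1 : ℝ)) (p.2 x i) = _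
    rw [real_inner_smul_left, EuclideanSpace.inner_single_left]
    simp
  have e3 : advection p.1 q.2 q.1
      = ∫ x in Ω, ∑ i, (p.1 x) i * inner ℝ (classicalGrad φ x i) (φ x) := by
    refine integral_congr_ae ?_
    filter_upwards [h1, h2] with x hx1 hx2
    simp only [hx1, hx2]
  rw [e3, ← e1, ← e2]
  have hcl : IsClosed {p : L2 Ω × L2Grad Ω | inner ℝ m₁.toLp p.1 = -inner ℝ m₂.toLp p.2} :=
    isClosed_eq (by fun_prop) (by fun_prop)
  refine hcl.closure_subset_iff.2 ?_ hp
  rintro p ⟨ψ, hψ, hψc, hψs, hp1, hp2⟩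
  change inner ℝ m₁.toLp p.1 = -inner ℝ m₂.toLp p.2
  rw [e1, e2]
  have f1 : ∫ x in Ω, ∑ i, (p.1 x) i * inner ℝ (classicalGrad φ x i) (φ x)
      = ∫ x in Ω, ∑ i, (ψ x) i * inner ℝ (classicalGrad φ x i) (φ x) :=
    integral_congr_ae (hp1.mono fun x hx => by simp only [hx])
  have f2 : ∫ x in Ω, 1 / 2 * ‖φ x‖ ^ 2 * ∑ i, (p.2 x i) i
      = ∫ x in Ω, 1 / 2 * ‖φ x‖ ^ 2 * ∑ i, (classicalGrad ψ x i) i :=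
    integral_congr_ae (hp2.mono fun x hx => by simp only [hx])
  rw [f1, f2, setIntegral_eq_integral_of_forall_compl_eq_zero (fun x hx => by
      simp [image_eq_zero_of_notMem_tsupport fun h => hx (hψs h)]),
    setIntegral_eq_integral_of_forall_compl_eq_zero (fun x hx => by
      simp [classicalGrad_eq_zero fun h => hx (hψs h)])]
  exact integral_advection_test hφ hψ hψc

open Filter Topology in
/-- `b(w, v, v) = 0` for divergence free `w`. -/
lemma advection_self_eq_zero (hΩ : Bornology.IsBounded Ω) {w v : L2 Ω × L2Grad Ω} (hw : w ∈ V Ω)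
    (hv : v ∈ H10 Ω) : advection w.1 v.2 v.1 = 0 := by
  have hwH : w ∈ H10 Ω := hw.1
  have htest : ∀ q ∈ testGraph Ω, advection w.1 q.2 q.1 = 0 := by
    rintro q ⟨φ, hφ, hc, hs, h1, h2⟩
    rw [advection_test hwH hφ hc h1 h2, neg_eq_zero]
    have hdiv : ∀ᵐ x ∂(volume.restrict Ω), ∑ i, (w.2 x i) i = 0 := hw.2
    refine (integral_congr_ae (hdiv.mono fun x hx => ?_)).trans (integral_zero _ _)
    simp only [hx, mul_zero]
  obtain ⟨q, hq, hqv⟩ := exists_test_seq hv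
  have hqH : ∀ n, q n ∈ H10 Ω := fun n => subset_closure (hq n)
  have hdec : ∀ n, advection w.1 v.2 v.1
      = advection w.1 (v - q n).2 v.1 + advection w.1 (q n).2 (v - q n).1 := by
    intro n
    have a1 := advection_add_middle hΩ hwH (v - q n).2 (q n).2 hv
    have a2 := advection_add_right hΩ hwH (q n).2 (hqH n) ((H10 Ω).sub_mem hv (hqH n))
    rw [htest _ (hq n)] at a2
    simp only [Prod.snd_sub, sub_add_cancel] at a1
    simp only [Prod.fst_sub, add_sub_cancel] at a2
    simp only [Prod.snd_sub, Prod.fst_sub]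
    rw [a1, a2, zero_add]
  have hsub : Tendsto (fun n => v - q n) atTop (𝓝 0) := by
    have h := (tendsto_const_nhds (x := v)).sub hqv
    rwa [sub_self] at h
  have hz1 : Tendsto (fun n => (v - q n).1) atTop (𝓝 0) := (continuous_fst.tendsto _).comp hsub
  have hz2 : Tendsto (fun n => (v - q n).2) atTop (𝓝 0) := (continuous_snd.tendsto _).comp hsub
  have hq2 : Tendsto (fun n => (q n).2) atTop (𝓝 v.2) := (continuous_snd.tendsto _).comp hqv
  have t1 : Tendsto (fun n => advection w.1 (v - q n).2 v.1) atTop (𝓝 0) := by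
    have : Tendsto (fun n => advection w.1 (v - q n).2 v.1 ^ 2) atTop (𝓝 0) := by
      refine squeeze_zero (fun n => sq_nonneg _)
        (fun n => advection_sq_le hΩ hwH (v - q n).2 hv) ?_
      have h := ((hz2.norm.pow 2).const_mul (1 / 2)).mul_const
        (‖w.1‖ * ‖w.2‖ * (‖v.1‖ * ‖v.2‖))
      rwa [norm_zero, zero_pow two_ne_zero, mul_zero, zero_mul] at h
    have h := this.sqrt
    simp only [Real.sqrt_sq_eq_abs, Real.sqrt_zero] at h
    exact (tendsto_zero_iff_abs_tendsto_zero _).2 h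
  have t2 : Tendsto (fun n => advection w.1 (q n).2 (v - q n).1) atTop (𝓝 0) := by
    have : Tendsto (fun n => advection w.1 (q n).2 (v - q n).1 ^ 2) atTop (𝓝 0) := by
      refine squeeze_zero (fun n => sq_nonneg _)
        (fun n => advection_sq_le hΩ hwH (q n).2 ((H10 Ω).sub_mem hv (hqH n))) ?_
      have h := ((hq2.norm.pow 2).const_mul (1 / 2)).mul
        ((hz1.norm.mul hz2.norm).const_mul (‖w.1‖ * ‖w.2‖))
      rwa [norm_zero, norm_zero, zero_mul, mul_zero, mul_zero] at h
    have h := this.sqrt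
    simp only [Real.sqrt_sq_eq_abs, Real.sqrt_zero] at h
    exact (tendsto_zero_iff_abs_tendsto_zero _).2 h
  have t3 := t1.add t2
  simp only [← hdec, add_zero] at t3
  exact tendsto_nhds_unique tendsto_const_nhds t3

end Advection

/-! ### The smallest Stokes eigenvalue and Poincaré's inequality -/

section Poincare

variable {Ω : Set Plane}

/-- Up to a small multiple of the gradient, the `L²`-norm on `H₀¹` is controlled by finitely many
linear functionals. This is the form in which the compactness of `H₀¹ ⊂ L²` is used. -/
lemma exists_friedrichs (hΩ : Bornology.IsBounded Ω) {η : ℝ} (hη : 0 < η) :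
    ∃ (ι : Type) (_ : Fintype ι) (G : ι → L2 Ω), ∀ p ∈ H10 Ω,
      ‖p.1‖ ^ 2 ≤ ∑ j, inner ℝ (G j) p.1 ^ 2 + η * ‖p.2‖ ^ 2 := by
  obtain ⟨R, hR, hΩR⟩ : ∃ R, 0 < R ∧ Ω ⊆ Metric.ball 0 R := by
    obtain ⟨R, hR⟩ := hΩ.subset_ball 0
    exact ⟨max R 1, by positivity, hR.trans (Metric.ball_subset_ball (le_max_left _ _))⟩
  have : IsFiniteMeasure (volume.restrict Ω) :=
    ⟨by rw [Measure.restrict_apply_univ]; exact hΩ.measure_lt_top⟩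
  obtain ⟨n, hn, hnη⟩ : ∃ n : ℕ, 0 < n ∧ (2 * R / n) ^ 2 ≤ η := by
    obtain ⟨n, hn⟩ := exists_nat_gt (2 * R / √η)
    have h1 : 0 < 2 * R / √η := by positivity
    have hn0 : (0 : ℝ) < n := h1.trans hn
    refine ⟨n, by exact_mod_cast hn0, ?_⟩
    rw [div_lt_iff₀ (by positivity)] at hn
    calc (2 * R / n) ^ 2 ≤ √η ^ 2 := by
          gcongr
          rw [div_le_iff₀ hn0]
          linarith
      _ = η := Real.sq_sqrt hη.le
  set h : ℝ := 2 * R / n with hh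
  let Q : ℕ → ℕ → Set Plane := fun k l =>
    planeBox (-R + l * h) (-R + l * h + h) (-R + k * h) (-R + k * h + h)
  have hQ : ∀ k l, MeasurableSet (Q k l) := fun k l => measurableSet_planeBox _ _ _ _
  let G : Fin n × Fin n × Fin 2 → L2 Ω := fun j => h⁻¹ • indicatorConstLp 2 (hQ j.1 j.2.1)
    (measure_ne_top (volume.restrict Ω) _) (EuclideanSpace.single j.2.2 (1 : ℝ))
  refine ⟨Fin n × Fin n × Fin 2, inferInstance, G, ?_⟩
  have hcl : IsClosed {p : L2 Ω × L2Grad Ω |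
      ‖p.1‖ ^ 2 ≤ ∑ j, inner ℝ (G j) p.1 ^ 2 + η * ‖p.2‖ ^ 2} :=
    isClosed_le (by fun_prop) (by fun_prop)
  refine fun p hp => hcl.closure_subset_iff.2 ?_ hp
  rintro p ⟨φ, hφ, hc, hs, h1, h2⟩
  change ‖p.1‖ ^ 2 ≤ ∑ j, inner ℝ (G j) p.1 ^ 2 + η * ‖p.2‖ ^ 2
  have key := friedrichs_test hR hΩR hφ hc hs hn
  rw [← norm_fst_sq_of_ae h1, ← norm_snd_sq_of_ae h2] at key
  have hφQ : ∀ k l, ∫ z in Q k l, φ z = ∫ z in Q k l, p.1 z ∂(volume.restrict Ω) := by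
    intro k l
    have e1 : ∫ z in Q k l, p.1 z ∂(volume.restrict Ω) = ∫ z in Q k l, φ z ∂(volume.restrict Ω) :=
      integral_congr_ae (ae_restrict_of_ae h1)
    rw [e1, Measure.restrict_restrict (hQ k l)]
    refine (setIntegral_eq_of_subset_of_forall_sdiff_eq_zero (f := φ) (hQ k l) inter_subset_left ?_)
    intro z hz
    exact image_eq_zero_of_notMem_tsupport fun hzs => hz.2 ⟨hz.1, hs hzs⟩
  have hsum : ∑ j, inner ℝ (G j) p.1 ^ 2 = h⁻¹ ^ 2 * ∑ k ∈ Finset.range n,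
      ∑ l ∈ Finset.range n, ‖∫ z in Q k l, φ z‖ ^ 2 := by
    rw [Fintype.sum_prod_type, Finset.mul_sum, Finset.sum_range]
    refine Finset.sum_congr rfl fun k _ => ?_
    rw [Fintype.sum_prod_type, Finset.mul_sum, Finset.sum_range]
    refine Finset.sum_congr rfl fun l _ => ?_
    rw [hφQ, EuclideanSpace.norm_sq_eq, Finset.mul_sum]
    refine Finset.sum_congr rfl fun i _ => ?_
    rw [real_inner_smul_left, L2.inner_indicatorConstLp_eq_inner_setIntegral,
      EuclideanSpace.inner_single_left, mul_pow, Real.norm_eq_abs, sq_abs]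
    simp
  rw [hsum]
  exact key.trans (by gcongr)

lemma isClosed_divFree (Ω : Set Plane) : IsClosed (divFree Ω : Set (L2 Ω × L2Grad Ω)) := by
  let T : GradVal →L[ℝ] ℝ := ∑ i : Fin 2, (EuclideanSpace.proj i : Plane →L[ℝ] ℝ).comp
    (PiLp.proj 2 (fun _ : Fin 2 => Plane) i : GradVal →L[ℝ] Plane)
  have hT : ∀ g : GradVal, T g = ∑ i, (g i) i := by
    intro g
    simp [T]
  have : (divFree Ω : Set (L2 Ω × L2Grad Ω))
      = {p | T.compLpL 2 (volume.restrict Ω) p.2 = 0} := by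
    ext p
    change (∀ᵐ x ∂(volume.restrict Ω), ∑ i, (p.2 x i) i = 0)
      ↔ T.compLpL 2 (volume.restrict Ω) p.2 = 0
    rw [Lp.eq_zero_iff_ae_eq_zero]
    have h := T.coeFn_compLpL (p := 2) (μ := volume.restrict Ω) p.2
    constructor
    · intro hp
      filter_upwards [h, hp] with x hx hpx
      rw [hx, hT, hpx]
      rfl
    · intro hp
      filter_upwards [h, hp] with x hx hpx
      rw [← hT, ← hx, hpx]
      rfl
  rw [this]
  exact isClosed_eq (by fun_prop) continuous_const

lemma isClosed_V (Ω : Set Plane) : IsClosed (V Ω : Set (L2 Ω × L2Grad Ω)) :=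
  (Submodule.isClosed_topologicalClosure _).inter (isClosed_divFree Ω)

/-- The arithmetic behind `exists_rayleigh_minimizer`: there `A`, `A'` are the energies of two
normalized members of a minimizing sequence, and `N`, `D` the squared norms of the differences of
the members and of their gradients. -/
lemma gap_bound {m N D E A A' : ℝ} (hm : 0 ≤ m) (hE : 0 ≤ E) (hD : 0 ≤ D)
    (h1 : N ≤ E + 1 / (2 * (m + 1)) * D) (h2 : m * (4 - N) ≤ 2 * (A + A') - D) :
    N ≤ 4 * (A - m) + 4 * (A' - m) + (2 * m + 1) * E
      ∧ D ≤ 4 * (A - m) + 4 * (A' - m) + (2 * m + 1) * E := by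
  have k1 : 1 / (2 * (m + 1)) * D ≤ 1 / 2 * D := by
    gcongr
    linarith
  have k2 : m * (1 / (2 * (m + 1)) * D) ≤ 1 / 2 * D := by
    rw [← mul_assoc]
    gcongr
    rw [mul_one_div, div_le_div_iff₀ (by positivity) (by positivity)]
    linarith
  have k3 := mul_le_mul_of_nonneg_left h1 hm
  have k4 := mul_nonneg hm hE
  constructor <;> linarith

open Filter Topology in
/-- The Rayleigh quotient on `V` attains its infimum. By `exists_friedrichs` and the parallelogram
law a minimizing sequence has a Cauchy subsequence. -/
lemma exists_rayleigh_minimizer (hΩ : Bornology.IsBounded Ω) (hV : ∃ v ∈ V Ω, v.1 ≠ 0) :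
    ∃ w ∈ V Ω, ‖w.1‖ = 1 ∧ ∀ v ∈ V Ω, ‖w.2‖ ^ 2 * ‖v.1‖ ^ 2 ≤ ‖v.2‖ ^ 2 := by
  set S : Set ℝ := {r | ∃ v ∈ V Ω, ‖v.1‖ = 1 ∧ ‖v.2‖ ^ 2 = r} with hS
  have hnormalize : ∀ v ∈ V Ω, v.1 ≠ 0 → ‖v.2‖ ^ 2 / ‖v.1‖ ^ 2 ∈ S := by
    intro v hv h0
    have hn : ‖v.1‖ ≠ 0 := norm_ne_zero_iff.2 h0
    refine ⟨‖v.1‖⁻¹ • v, (V Ω).smul_mem _ hv, ?_, ?_⟩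
    · rw [Prod.smul_fst, norm_smul, norm_inv, norm_norm, inv_mul_cancel₀ hn]
    · rw [Prod.smul_snd, norm_smul, norm_inv, norm_norm]
      field_simp
  have hne : S.Nonempty := by
    obtain ⟨v, hv, h0⟩ := hV
    exact ⟨_, hnormalize v hv h0⟩
  have hbdd : BddBelow S := ⟨0, by rintro r ⟨v, -, -, rfl⟩; positivity⟩
  set m := sInf S with hm
  have hm0 : 0 ≤ m := le_csInf hne (by rintro r ⟨v, -, -, rfl⟩; positivity)
  have hmin : ∀ v ∈ V Ω, m * ‖v.1‖ ^ 2 ≤ ‖v.2‖ ^ 2 := by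
    intro v hv
    by_cases h0 : v.1 = 0
    · rw [h0, norm_zero, zero_pow two_ne_zero, mul_zero]
      positivity
    · have h1 := csInf_le hbdd (hnormalize v hv h0)
      have : 0 < ‖v.1‖ := norm_pos_iff.2 h0
      rwa [le_div_iff₀ (by positivity)] at h1
  obtain ⟨r, -, hr, hrS⟩ := exists_seq_tendsto_sInf hne hbdd
  choose w hwV hw1 hw2 using hrS
  obtain ⟨ι, hι, G, hG⟩ := exists_friedrichs hΩ (η := 1 / (2 * (m + 1))) (by positivity)
  -- the finitely many functionals converge along a subsequence
  obtain ⟨a, -, σ, hσ, ha⟩ := tendsto_subseq_of_bounded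
    (s := Metric.closedBall (0 : ι → ℝ) (∑ j, ‖G j‖)) Metric.isBounded_closedBall
    (x := fun k j => inner ℝ (G j) (w k).1) (by
      intro k
      rw [mem_closedBall_zero_iff, pi_norm_le_iff_of_nonneg (by positivity)]
      intro j
      have := norm_inner_le_norm (𝕜 := ℝ) (G j) (w k).1
      rw [hw1, mul_one] at this
      exact this.trans (Finset.single_le_sum (f := fun j => ‖G j‖) (fun _ _ => norm_nonneg _)
        (Finset.mem_univ j)))
  set z : ℕ → L2 Ω × L2Grad Ω := fun k => w (σ k) with hz
  have hzV : ∀ k, z k ∈ V Ω := fun k => hwV _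
  have hz1 : ∀ k, ‖(z k).1‖ = 1 := fun k => hw1 _
  have hz2 : Tendsto (fun k => ‖(z k).2‖ ^ 2) atTop (𝓝 m) := by
    simp only [hz, hw2]
    exact hr.comp hσ.tendsto_atTop
  have ha' : ∀ j, Tendsto (fun k => inner ℝ (G j) (z k).1) atTop (𝓝 (a j)) :=
    fun j => (tendsto_pi_nhds.1 ha) j
  set e : ℕ × ℕ → ℝ := fun kl =>
    ∑ j, (inner ℝ (G j) (z kl.1).1 - inner ℝ (G j) (z kl.2).1) ^ 2 with he
  have hfst : Tendsto (Prod.fst : ℕ × ℕ → ℕ) atTop atTop := by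
    rw [← prod_atTop_atTop_eq]; exact tendsto_fst
  have hsnd : Tendsto (Prod.snd : ℕ × ℕ → ℕ) atTop atTop := by
    rw [← prod_atTop_atTop_eq]; exact tendsto_snd
  have he0 : Tendsto e atTop (𝓝 0) := by
    have := tendsto_finsetSum (Finset.univ : Finset ι) (fun j _ =>
      ((((ha' j).comp hfst).sub ((ha' j).comp hsnd)).pow 2))
    simpa only [sub_self, zero_pow two_ne_zero, Finset.sum_const_zero, Function.comp_def] using this
  set B : ℕ × ℕ → ℝ := fun kl => 4 * (‖(z kl.1).2‖ ^ 2 - m) + 4 * (‖(z kl.2).2‖ ^ 2 - m)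
    + (2 * m + 1) * e kl with hB
  have hB0 : Tendsto B atTop (𝓝 0) := by
    have := ((((hz2.comp hfst).sub_const m).const_mul 4).add
      (((hz2.comp hsnd).sub_const m).const_mul 4)).add (he0.const_mul (2 * m + 1))
    simpa only [sub_self, mul_zero, add_zero, Function.comp_def] using this
  have hest : ∀ kl : ℕ × ℕ, ‖(z kl.1).1 - (z kl.2).1‖ ^ 2 ≤ B kl
      ∧ ‖(z kl.1).2 - (z kl.2).2‖ ^ 2 ≤ B kl := by
    rintro ⟨k, l⟩
    have f1 := hG (z k - z l) (((V Ω).sub_mem (hzV k) (hzV l)).1)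
    have f2 := hmin (z k + z l) ((V Ω).add_mem (hzV k) (hzV l))
    have f3 := parallelogram_law_with_norm ℝ (z k).1 (z l).1
    have f4 := parallelogram_law_with_norm ℝ (z k).2 (z l).2
    have f5 := hmin (z k) (hzV k)
    have f6 := hmin (z l) (hzV l)
    simp only [Prod.fst_sub, Prod.snd_sub, Prod.fst_add, Prod.snd_add, inner_sub_right, hz1]
      at f1 f2 f3 f5 f6
    change _ ≤ e (k, l) + _ at f1
    have e0 : 0 ≤ e (k, l) := Finset.sum_nonneg fun _ _ => sq_nonneg _
    simp only [hB]
    generalize e (k, l) = E at *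
    have hD : 0 ≤ ‖(z k).2 - (z l).2‖ ^ 2 := sq_nonneg _
    have f7 : m * (4 - ‖(z k).1 - (z l).1‖ ^ 2)
        ≤ 2 * (‖(z k).2‖ ^ 2 + ‖(z l).2‖ ^ 2) - ‖(z k).2 - (z l).2‖ ^ 2 := by
      rw [show 4 - ‖(z k).1 - (z l).1‖ ^ 2 = ‖(z k).1 + (z l).1‖ ^ 2 by linarith]
      linarith
    exact gap_bound hm0 e0 hD f1 f7
  have hcauchy : ∀ {E : Type} [NormedAddCommGroup E] (y : ℕ → E),
      (∀ kl : ℕ × ℕ, ‖y kl.1 - y kl.2‖ ^ 2 ≤ B kl) → CauchySeq y := by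
    intro E _ y hy
    rw [cauchySeq_iff_tendsto_dist_atTop_0]
    have h1 : Tendsto (fun kl : ℕ × ℕ => ‖y kl.1 - y kl.2‖ ^ 2) atTop (𝓝 0) :=
      squeeze_zero (fun _ => sq_nonneg _) hy hB0
    have h2 := h1.sqrt
    simpa only [Real.sqrt_zero, Real.sqrt_sq (norm_nonneg _), dist_eq_norm] using h2
  obtain ⟨p1, hp1⟩ := cauchySeq_tendsto_of_complete
    (hcauchy (fun k => (z k).1) fun kl => (hest kl).1)
  obtain ⟨p2, hp2⟩ := cauchySeq_tendsto_of_complete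
    (hcauchy (fun k => (z k).2) fun kl => (hest kl).2)
  refine ⟨(p1, p2), (isClosed_V Ω).mem_of_tendsto (hp1.prodMk_nhds hp2) (.of_forall hzV), ?_, ?_⟩
  · exact tendsto_nhds_unique hp1.norm (by simp only [hz1]; exact tendsto_const_nhds)
  · have : ‖p2‖ ^ 2 = m := tendsto_nhds_unique (hp2.norm.pow 2) hz2
    intro v hv
    change ‖p2‖ ^ 2 * ‖v.1‖ ^ 2 ≤ _
    rw [this]
    exact hmin v hv

/-- Poincaré's inequality on `V` with the constant `λ₁`: a minimizer of the Rayleigh quotient is an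
eigenfunction, by the vanishing of the first variation. -/
lemma stokesLambda_mul_le (hΩ : Bornology.IsBounded Ω) (v : V Ω) :
    stokesLambda Ω * ‖vel v‖ ^ 2 ≤ ‖grad v‖ ^ 2 := by
  by_cases hV : ∃ v ∈ V Ω, v.1 ≠ 0
  · obtain ⟨w, hw, hw1, hmin⟩ := exists_rayleigh_minimizer hΩ hV
    have heig : IsStokesEigenvalue Ω (‖w.2‖ ^ 2) := by
      refine ⟨⟨w, hw⟩, ?_, ?_⟩
      · change w.1 ≠ 0
        rw [← norm_ne_zero_iff, hw1]
        exact one_ne_zero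
      · intro v
        change inner ℝ w.2 v.1.2 = ‖w.2‖ ^ 2 * inner ℝ w.1 v.1.1
        have key : ∀ t : ℝ, 0 ≤ (‖v.1.2‖ ^ 2 - ‖w.2‖ ^ 2 * ‖v.1.1‖ ^ 2) * (t * t)
            + (2 * (inner ℝ w.2 v.1.2 - ‖w.2‖ ^ 2 * inner ℝ w.1 v.1.1)) * t + 0 := by
          intro t
          have h := hmin (w + t • v.1) ((V Ω).add_mem hw ((V Ω).smul_mem t v.2))
          rw [Prod.fst_add, Prod.snd_add, Prod.smul_fst, Prod.smul_snd, norm_add_sq_real,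
            norm_add_sq_real, hw1, real_inner_smul_right, real_inner_smul_right, norm_smul,
            norm_smul, mul_pow, mul_pow, Real.norm_eq_abs, sq_abs] at h
          linarith
        have h := discrim_le_zero key
        rw [discrim, mul_zero, sub_zero] at h
        have h0 := pow_eq_zero_iff two_ne_zero |>.1 (le_antisymm h (sq_nonneg _))
        linarith
    have hle : stokesLambda Ω ≤ ‖w.2‖ ^ 2 := by
      refine csInf_le ⟨0, ?_⟩ heig
      rintro lam ⟨u, hu, hlam⟩
      have h := hlam u
      rw [real_inner_self_eq_norm_sq, real_inner_self_eq_norm_sq] at h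
      have h0 : 0 < ‖vel u‖ ^ 2 := by
        have := norm_pos_iff.2 hu
        positivity
      by_contra! hneg
      have := mul_neg_of_neg_of_pos hneg h0
      have := sq_nonneg ‖grad u‖
      linarith
    exact (mul_le_mul_of_nonneg_right hle (sq_nonneg _)).trans (hmin v.1 v.2)
  · push Not at hV
    have : vel v = 0 := hV v.1 v.2
    rw [this, norm_zero]
    simp only [ne_eq, OfNat.ofNat_ne_zero, not_false_eq_true, zero_pow, mul_zero]
    positivity

end Poincare

/-! ### One step of the scheme -/

lemma comb_eq {M : Type*} [AddCommGroup M] [Module ℝ M] (c : Fin 3 → ℝ) (y : ℕ → M) {n : ℕ}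
    (hn : 1 ≤ n) : comb c y n = c 2 • y (n + 1) + c 1 • y n + c 0 • y (n - 1) := by
  have h1 : n - 1 + 1 = n := Nat.sub_add_cancel hn
  have h2 : n - 1 + 2 = n + 1 := by omega
  simp only [comb, Fin.sum_univ_three, Fin.val_zero, Fin.val_one, Fin.val_two, add_zero, h1, h2]
  abel

lemma mul_le_mul_sq_add {c : ℝ} (hc : 0 < c) (F r : ℝ) : F * r ≤ c * r ^ 2 + F ^ 2 / (4 * c) := by
  have h : c * r ^ 2 + F ^ 2 / (4 * c) - F * r = (2 * c * r - F) ^ 2 / (4 * c) := by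
    field_simp
    ring
  have : 0 ≤ (2 * c * r - F) ^ 2 / (4 * c) := by positivity
  linarith

/-- Young's inequality for the convection term. The number `k` plays the role of `ν (2β₂ - 1) / 8`,
and `B K²` that of the constant in the bound of the trilinear form. -/
lemma abs_le_of_sq_le_product {t k q S W X : ℝ} (hk : 0 < k) (hS : 0 ≤ S)
    (ht : t ^ 2 ≤ 1 / 2 * q * S * (W * X)) :
    |t| ≤ k * S + 4 * k * X ^ 2 + q ^ 2 / (1024 * k ^ 3) * W ^ 2 := by
  obtain ⟨r, hr⟩ : ∃ r, r = q / (32 * k ^ 2) := ⟨_, rfl⟩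
  have e1 : q ^ 2 / (1024 * k ^ 3) = k * r ^ 2 := by rw [hr]; field_simp; ring
  have e2 : q = 32 * k ^ 2 * r := by rw [hr]; field_simp
  rw [e1]
  have h0 : 0 ≤ k * S + 4 * k * X ^ 2 + k * r ^ 2 * W ^ 2 := by positivity
  refine abs_le_of_sq_le_sq (ht.trans ?_) h0
  have h1 : 0 ≤ 4 * (k * S) * (k * (2 * X - r * W) ^ 2) := by positivity
  have h2 := sq_nonneg (k * S - (4 * k * X ^ 2 + k * r ^ 2 * W ^ 2))
  rw [e2]
  linarith

section Scheme

variable {Ω : Set Plane} {θ ν dt : ℝ} {f : ℝ → L2 Ω} {u : ℕ → V Ω}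

lemma beta_pos (h0 : 0 < θ) (h1 : θ < 1) (l : Fin 3) : 0 < beta θ l := by
  have : θ ^ 2 < 1 := pow_lt_one₀ h0.le h1 two_ne_zero
  fin_cases l
  · simp only [beta, Fin.zero_eta, Matrix.cons_val_zero]
    linarith [mul_pos (sub_pos.2 h1) (by linarith : 0 < 2 + θ)]
  · simp only [beta, Fin.mk_one, Matrix.cons_val_one, Matrix.cons_val_zero]
    positivity
  · simp only [beta, Fin.reduceFinMk, Matrix.cons_val]
    linarith

lemma beta_sum : beta θ 2 + beta θ 1 + beta θ 0 = 1 := by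
  simp only [beta, Matrix.cons_val_zero, Matrix.cons_val_one, Matrix.cons_val]
  ring

lemma two_mul_beta_sub_one_pos (h0 : 0 < θ) (h1 : θ < 1) : 0 < 2 * beta θ 2 - 1 := by
  have : 2 * beta θ 2 - 1 = θ * (1 - θ) / 2 := by
    simp only [beta, Matrix.cons_val]
    ring
  rw [this]
  have : 0 < 1 - θ := by linarith
  positivity

lemma vel_comb (c : Fin 3 → ℝ) (u : ℕ → V Ω) {n : ℕ} (hn : 1 ≤ n) :
    vel (comb c u n) = c 2 • vel (u (n + 1)) + c 1 • vel (u n) + c 0 • vel (u (n - 1)) := by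
  rw [comb_eq c u hn]
  rfl

lemma grad_comb (c : Fin 3 → ℝ) (u : ℕ → V Ω) {n : ℕ} (hn : 1 ≤ n) :
    grad (comb c u n) = c 2 • grad (u (n + 1)) + c 1 • grad (u n) + c 0 • grad (u (n - 1)) := by
  rw [comb_eq c u hn]
  rfl

/-- The force term is bounded by `‖f‖_∞`, since the intermediate time nodes are nonnegative. -/
lemma inner_force_le (h0 : 0 < θ) (h1 : θ < 1) (hdt : 0 < dt) (hf : IsForce f) {n : ℕ}
    (hn : 1 ≤ n) (v : L2 Ω) :
    inner ℝ (f (comb (beta θ) (fun k : ℕ => (k : ℝ) * dt) n)) v ≤ forceNorm f * ‖v‖ := by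
  refine (real_inner_le_norm _ _).trans ?_
  gcongr
  refine hf.2 _ ?_
  rw [comb_eq _ _ hn]
  have := beta_pos h0 h1 0
  have := beta_pos h0 h1 1
  have := beta_pos h0 h1 2
  positivity

/-- The energy identity: the scheme tested with `u_{n,β}`. -/
lemma energy_step (hΩ : Bornology.IsBounded Ω) (h0 : 0 < θ) (h1 : θ < 1) (hdt : 0 < dt)
    (hf : IsForce f) (hu : IsDLNSolution θ ν dt f u) {n : ℕ} (hn : 1 ≤ n) :
    gNormSq θ (vel (u (n + 1))) (vel (u n)) - gNormSq θ (vel (u n)) (vel (u (n - 1)))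
      + ‖dissip θ 2 • vel (u (n + 1)) + dissip θ 1 • vel (u n) + dissip θ 0 • vel (u (n - 1))‖ ^ 2
      + ν * dt * ‖grad (comb (beta θ) u n)‖ ^ 2
      ≤ dt * (forceNorm f * ‖vel (comb (beta θ) u n)‖) := by
  have h := hu n hn (comb (beta θ) u n)
  have hb : trilinear (comb (beta θ) u n) (comb (beta θ) u n) (comb (beta θ) u n) = 0 :=
    advection_self_eq_zero hΩ (comb (beta θ) u n).2 (comb (beta θ) u n).2.1
  rw [hb, add_zero, real_inner_self_eq_norm_sq] at h
  have hα := inner_alpha_beta h0 h1 (vel (u (n + 1))) (vel (u n)) (vel (u (n - 1)))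
  rw [← vel_comb _ u hn, ← vel_comb _ u hn] at hα
  rw [hα] at h
  have hF := inner_force_le h0 h1 hdt hf hn (vel (comb (beta θ) u n))
  rw [← h] at hF
  have := mul_le_mul_of_nonneg_left hF hdt.le
  rw [mul_add, ← mul_assoc, mul_one_div_cancel hdt.ne', one_mul] at this
  linarith

/-- The scheme tested with `u_{n+1}`. With `δ = (2β₂ - 1)/8`, of the dissipation
`ν δ (6 ‖∇u_{n+1}‖² + ‖∇uₙ‖² + ‖∇u_{n-1}‖²)` one multiple of `ν δ ‖∇u_{n+1}‖²` is kept, one absorbs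
the force, and the remainder absorbs the convection term. The latter equals
`b(u_{n,β}, β₁ uₙ + β₀ u_{n-1}, u_{n+1})`, because `b(u_{n,β}, u_{n+1}, u_{n+1}) = 0`. -/
lemma gradient_step (hΩ : Bornology.IsBounded Ω) (h0 : 0 < θ) (h1 : θ < 1) (hν : 0 < ν)
    (hdt : 0 < dt) (hlam : 0 < stokesLambda Ω) (hf : IsForce f) (hu : IsDLNSolution θ ν dt f u)
    {K : ℝ} (hK : ∀ n, ‖vel (u n)‖ ≤ K) {n : ℕ} (hn : 1 ≤ n) :
    dt * (ν * (2 * beta θ 2 - 1) / 8) * ‖grad (u (n + 1))‖ ^ 2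
        + (θ / 2 * ‖vel (u (n + 1)) - vel (u n)‖ ^ 2
          + 1 / 4 * (1 - θ) * ‖vel (u (n + 1)) - vel (u (n - 1))‖ ^ 2)
        + ν * dt * (beta θ 1 / 2 * ‖grad (u (n + 1)) + grad (u n)‖ ^ 2
          + beta θ 0 / 2 * ‖grad (u (n + 1)) + grad (u (n - 1))‖ ^ 2)
        + (gNormSq θ (vel (u (n + 1))) (vel (u n))
          + dt * ν * (1 / 4 * ‖grad (u (n + 1))‖ ^ 2
            + (beta θ 0 / 2 + (2 * beta θ 2 - 1) / 8) * ‖grad (u n)‖ ^ 2))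
      ≤ gNormSq θ (vel (u n)) (vel (u (n - 1)))
          + dt * ν * (1 / 4 * ‖grad (u n)‖ ^ 2
            + (beta θ 0 / 2 + (2 * beta θ 2 - 1) / 8) * ‖grad (u (n - 1))‖ ^ 2)
        + dt * (2 / (ν * (2 * beta θ 2 - 1) * stokesLambda Ω) * forceNorm f ^ 2)
        + dt * (K ^ 4 * (beta θ 0 ^ 2 + beta θ 1 ^ 2) ^ 2 / (2 * ν ^ 3 * (2 * beta θ 2 - 1) ^ 3)
          * ‖grad (comb (beta θ) u n)‖ ^ 2) := by
  have hb0 := beta_pos h0 h1 0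
  have hb1 := beta_pos h0 h1 1
  have hb2 := beta_pos h0 h1 2
  have hD := two_mul_beta_sub_one_pos h0 h1
  have h := hu n hn (u (n + 1))
  set w := comb (beta θ) u n with hw
  set s : V Ω := beta θ 1 • u n + beta θ 0 • u (n - 1) with hs
  have hα := inner_alpha_first (θ := θ) (vel (u (n + 1))) (vel (u n)) (vel (u (n - 1)))
  rw [← vel_comb _ u hn] at hα
  have hβ := inner_beta_first (θ := θ) (grad (u (n + 1))) (grad (u n)) (grad (u (n - 1)))
  rw [← grad_comb _ u hn, ← hw] at hβ
  -- the convection term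
  have hconv : trilinear w w (u (n + 1)) = advection (vel w) (grad s) (vel (u (n + 1))) := by
    have e : grad w = beta θ 2 • grad (u (n + 1)) + grad s := by
      rw [hw, grad_comb _ u hn, add_assoc]
      rfl
    change advection (vel w) (grad w) (vel (u (n + 1))) = _
    have e1 : advection (vel w) (beta θ 2 • grad (u (n + 1)) + grad s) (vel (u (n + 1)))
        = advection (vel w) (beta θ 2 • grad (u (n + 1))) (vel (u (n + 1)))
          + advection (vel w) (grad s) (vel (u (n + 1))) :=
      advection_add_middle hΩ w.2.1 _ _ (u (n + 1)).2.1
    have e2 : advection (vel w) (grad (u (n + 1))) (vel (u (n + 1))) = 0 :=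
      advection_self_eq_zero hΩ w.2 (u (n + 1)).2.1
    rw [e, e1, advection_smul_middle, e2, mul_zero, zero_add]
  have hK0 : 0 ≤ K := (norm_nonneg _).trans (hK 0)
  have hwK : ‖vel w‖ ≤ K := by
    rw [hw, vel_comb _ u hn]
    calc _ ≤ ‖beta θ 2 • vel (u (n + 1))‖ + ‖beta θ 1 • vel (u n)‖
          + ‖beta θ 0 • vel (u (n - 1))‖ := norm_add₃_le
      _ = beta θ 2 * ‖vel (u (n + 1))‖ + beta θ 1 * ‖vel (u n)‖
          + beta θ 0 * ‖vel (u (n - 1))‖ := by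
        simp only [norm_smul, Real.norm_of_nonneg hb0.le, Real.norm_of_nonneg hb1.le,
          Real.norm_of_nonneg hb2.le]
      _ ≤ beta θ 2 * K + beta θ 1 * K + beta θ 0 * K := by gcongr <;> exact hK _
      _ = K := by rw [← add_mul, ← add_mul, beta_sum, one_mul]
  have hgs : ‖grad s‖ ^ 2 ≤ (beta θ 0 ^ 2 + beta θ 1 ^ 2)
      * (‖grad (u n)‖ ^ 2 + ‖grad (u (n - 1))‖ ^ 2) := by
    have k : ‖grad s‖ ≤ beta θ 1 * ‖grad (u n)‖ + beta θ 0 * ‖grad (u (n - 1))‖ := by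
      change ‖beta θ 1 • grad (u n) + beta θ 0 • grad (u (n - 1))‖ ≤ _
      refine (norm_add_le _ _).trans_eq ?_
      simp only [norm_smul, Real.norm_of_nonneg hb0.le, Real.norm_of_nonneg hb1.le]
    calc ‖grad s‖ ^ 2 ≤ (beta θ 1 * ‖grad (u n)‖ + beta θ 0 * ‖grad (u (n - 1))‖) ^ 2 := by gcongr
      _ ≤ _ := by linarith [sq_nonneg (beta θ 1 * ‖grad (u (n - 1))‖ - beta θ 0 * ‖grad (u n)‖)]
  have hsq : advection (vel w) (grad s) (vel (u (n + 1))) ^ 2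
      ≤ 1 / 2 * (K ^ 2 * (beta θ 0 ^ 2 + beta θ 1 ^ 2))
        * (‖grad (u n)‖ ^ 2 + ‖grad (u (n - 1))‖ ^ 2) * (‖grad w‖ * ‖grad (u (n + 1))‖) := by
    have k : advection (vel w) (grad s) (vel (u (n + 1))) ^ 2
        ≤ 1 / 2 * ‖grad s‖ ^ 2
          * (‖vel w‖ * ‖grad w‖ * (‖vel (u (n + 1))‖ * ‖grad (u (n + 1))‖)) :=
      advection_sq_le hΩ w.2.1 (grad s) (u (n + 1)).2.1
    refine k.trans ?_
    calc _ ≤ 1 / 2 * ((beta θ 0 ^ 2 + beta θ 1 ^ 2)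
          * (‖grad (u n)‖ ^ 2 + ‖grad (u (n - 1))‖ ^ 2))
          * (K * ‖grad w‖ * (K * ‖grad (u (n + 1))‖)) := by
            gcongr
            exact hK _
      _ = _ := by ring
  have hyoung := neg_le_of_abs_le (abs_le_of_sq_le_product
    (k := ν * ((2 * beta θ 2 - 1) / 8)) (by positivity) (by positivity) hsq)
  have hM : (K ^ 2 * (beta θ 0 ^ 2 + beta θ 1 ^ 2)) ^ 2
      / (1024 * (ν * ((2 * beta θ 2 - 1) / 8)) ^ 3)
      = K ^ 4 * (beta θ 0 ^ 2 + beta θ 1 ^ 2) ^ 2 / (2 * ν ^ 3 * (2 * beta θ 2 - 1) ^ 3) := by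
    field_simp
    ring
  rw [hM] at hyoung
  -- the force term
  have hforce : inner ℝ (f (comb (beta θ) (fun k : ℕ => (k : ℝ) * dt) n)) (vel (u (n + 1)))
      ≤ ν * ((2 * beta θ 2 - 1) / 8) * ‖grad (u (n + 1))‖ ^ 2
        + 2 / (ν * (2 * beta θ 2 - 1) * stokesLambda Ω) * forceNorm f ^ 2 := by
    refine (inner_force_le h0 h1 hdt hf hn _).trans ?_
    refine (mul_le_mul_sq_add (c := ν * ((2 * beta θ 2 - 1) / 8) * stokesLambda Ω)
      (by positivity) _ _).trans ?_
    have hp := mul_le_mul_of_nonneg_left (stokesLambda_mul_le hΩ (u (n + 1)))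
      (by positivity : 0 ≤ ν * ((2 * beta θ 2 - 1) / 8))
    have e : forceNorm f ^ 2 / (4 * (ν * ((2 * beta θ 2 - 1) / 8) * stokesLambda Ω))
        = 2 / (ν * (2 * beta θ 2 - 1) * stokesLambda Ω) * forceNorm f ^ 2 := by
      field_simp
      ring
    rw [e]
    linarith
  rw [← h, hα, hβ, hconv] at hforce
  have hfin := mul_le_mul_of_nonneg_left hforce hdt.le
  have hfin2 := mul_le_mul_of_nonneg_left hyoung hdt.le
  rw [mul_add, mul_add, ← mul_assoc dt (1 / dt), mul_one_div_cancel hdt.ne', one_mul] at hfin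
  linarith

/-- Telescoping of a one-step estimate. -/
lemma sum_Icc_add_le_of_step {A S : ℕ → ℝ} {c : ℝ} {i N : ℕ} (hi : 1 ≤ i) (hiN : i ≤ N)
    (h : ∀ n, i ≤ n → A n + S (n + 1) ≤ S n + c) :
    ∑ n ∈ Finset.Icc i (N - 1), A n + S N ≤ S i + ((N : ℝ) - i) * c := by
  have e : Finset.Icc i (N - 1) = Finset.Ico i N := by
    ext n
    simp only [Finset.mem_Icc, Finset.mem_Ico]
    omega
  rw [e]
  clear e
  induction N, hiN using Nat.le_induction with
  | base => simp
  | succ N hN ih =>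
    rw [Finset.sum_Ico_succ_top hN]
    have := h N hN
    push_cast
    linarith

end Scheme

/-! ### Stability -/

lemma step_bounds_of_lt_dtLimit {θ ν dt lam : ℝ} (h0 : 0 < θ) (h1 : θ < 1) (hν : 0 < ν)
    (hdt : 0 < dt) (h : dt < dtLimit θ ν lam) :
    0 < lam ∧ ν * dt * lam / 2 * (8 - 6 * θ ^ 2 + 3 * θ ^ 4) < 4 * (θ * (1 - θ ^ 2)) ∧
      ν * dt * lam / 2 < 1 - θ := by
  have hθ2 : θ ^ 2 < 1 := pow_lt_one₀ h0.le h1 two_ne_zero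
  have hq : 0 < 8 - 6 * θ ^ 2 + 3 * θ ^ 4 := by linarith [pow_pos h0 4]
  have hA : 0 < 8 * θ * (1 - θ ^ 2) / (8 - 6 * θ ^ 2 + 3 * θ ^ 4) := by
    have : 0 < 1 - θ ^ 2 := by linarith
    positivity
  have hm : 0 < min (8 * θ * (1 - θ ^ 2) / (8 - 6 * θ ^ 2 + 3 * θ ^ 4)) (2 * (1 - θ)) :=
    lt_min hA (by linarith)
  rw [dtLimit] at h
  have hlam : 0 < lam := by
    by_contra! hl
    have h2 : 1 / (ν * lam) ≤ 0 := one_div_nonpos.2 (mul_nonpos_of_nonneg_of_nonpos hν.le hl)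
    have := mul_nonpos_of_nonpos_of_nonneg h2 hm.le
    linarith
  have hnl : 0 < ν * lam := by positivity
  rw [one_div, ← div_eq_inv_mul, lt_div_iff₀ hnl, lt_min_iff, lt_div_iff₀ hq] at h
  exact ⟨hlam, by linarith, by linarith⟩

section Scheme

variable {Ω : Set Plane} {θ ν dt : ℝ} {f : ℝ → L2 Ω} {u : ℕ → V Ω}

/-- The energy identity with half of the dissipation spent on the force. -/
lemma energy_step_gradient (hΩ : Bornology.IsBounded Ω) (h0 : 0 < θ) (h1 : θ < 1) (hν : 0 < ν)
    (hdt : 0 < dt) (hlam : 0 < stokesLambda Ω) (hf : IsForce f) (hu : IsDLNSolution θ ν dt f u)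
    {n : ℕ} (hn : 1 ≤ n) :
    ν * dt * ‖grad (comb (beta θ) u n)‖ ^ 2 + 2 * gNormSq θ (vel (u (n + 1))) (vel (u n))
      ≤ 2 * gNormSq θ (vel (u n)) (vel (u (n - 1)))
        + dt / (ν * stokesLambda Ω) * forceNorm f ^ 2 := by
  have h := energy_step hΩ h0 h1 hdt hf hu hn
  have hy := mul_le_mul_sq_add (c := ν * stokesLambda Ω / 2) (by positivity) (forceNorm f)
    ‖vel (comb (beta θ) u n)‖
  have hp := mul_le_mul_of_nonneg_left (stokesLambda_mul_le hΩ (comb (beta θ) u n))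
    (by positivity : 0 ≤ ν * dt / 2)
  have hd := sq_nonneg
    ‖dissip θ 2 • vel (u (n + 1)) + dissip θ 1 • vel (u n) + dissip θ 0 • vel (u (n - 1))‖
  have hy' := mul_le_mul_of_nonneg_left hy hdt.le
  have e : dt * (forceNorm f ^ 2 / (4 * (ν * stokesLambda Ω / 2)))
      = 1 / 2 * (dt / (ν * stokesLambda Ω) * forceNorm f ^ 2) := by
    field_simp
    ring
  rw [mul_add, e] at hy'
  linarith

/-- The energy identity with half of the dissipation turned into damping in the `H`-norm. -/
lemma energy_step_hNormSq (hΩ : Bornology.IsBounded Ω) (h0 : 0 < θ) (h1 : θ < 1) (hν : 0 < ν)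
    (hdt : 0 < dt) (hlam : 0 < stokesLambda Ω) (hf : IsForce f) (hu : IsDLNSolution θ ν dt f u)
    {ε a b c h₁₁ h₂₂ : ℝ}
    (hid : ∀ x y z : L2 Ω, gNormSq θ x y - gNormSq θ y z
        + ‖dissip θ 2 • x + dissip θ 1 • y + dissip θ 0 • z‖ ^ 2
        + ν * dt * stokesLambda Ω / 2 * ‖beta θ 2 • x + beta θ 1 • y + beta θ 0 • z‖ ^ 2
      = (1 + ε) * hNormSq h₁₁ h₂₂ x y - hNormSq h₁₁ h₂₂ y z + ‖a • x + b • y + c • z‖ ^ 2)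
    {n : ℕ} (hn : 1 ≤ n) :
    (1 + ε) * hNormSq h₁₁ h₂₂ (vel (u (n + 1))) (vel (u n))
      ≤ hNormSq h₁₁ h₂₂ (vel (u n)) (vel (u (n - 1)))
        + dt / (2 * (ν * stokesLambda Ω)) * forceNorm f ^ 2 := by
  have h := energy_step hΩ h0 h1 hdt hf hu hn
  have hi := hid (vel (u (n + 1))) (vel (u n)) (vel (u (n - 1)))
  rw [← vel_comb (beta θ) u hn] at hi
  have hy := mul_le_mul_sq_add (c := ν * stokesLambda Ω / 2) (by positivity) (forceNorm f)
    ‖vel (comb (beta θ) u n)‖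
  have hp := mul_le_mul_of_nonneg_left (stokesLambda_mul_le hΩ (comb (beta θ) u n))
    (by positivity : 0 ≤ ν * dt)
  have hd := sq_nonneg ‖a • vel (u (n + 1)) + b • vel (u n) + c • vel (u (n - 1))‖
  have hy' := mul_le_mul_of_nonneg_left hy hdt.le
  have e : dt * (forceNorm f ^ 2 / (4 * (ν * stokesLambda Ω / 2)))
      = dt / (2 * (ν * stokesLambda Ω)) * forceNorm f ^ 2 := by
    field_simp
    ring
  rw [mul_add, e] at hy'
  linarith

/-- A discrete Gronwall inequality for a damped recursion. -/
lemma le_of_damped_step {H : ℕ → ℝ} {ε κ : ℝ} (hε : 0 < ε) (hκ : 0 ≤ κ)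
    (h : ∀ n, 1 ≤ n → (1 + ε) * H (n + 1) ≤ H n + κ) {N : ℕ} (hN : 1 ≤ N) :
    H N ≤ 1 / (1 + ε) ^ (N - 1) * H 1 + 1 / ε * κ := by
  have h1 : 0 < 1 + ε := by linarith
  induction N, hN using Nat.le_induction with
  | base =>
    have : 0 ≤ 1 / ε * κ := by positivity
    simp only [Nat.sub_self, pow_zero, div_one, one_mul]
    linarith
  | succ N hN ih =>
    have hs := h N hN
    have e1 : N + 1 - 1 = N - 1 + 1 := by omega
    have e2 : 1 / (1 + ε) ^ (N + 1 - 1) * H 1 + 1 / ε * κ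
        = (1 / (1 + ε) ^ (N - 1) * H 1 + 1 / ε * κ + κ) / (1 + ε) := by
      rw [e1, pow_succ]
      field_simp
      ring
    rw [e2, le_div_iff₀ h1]
    linarith

end Scheme

theorem mainTheorem2 :
    ∃ Ch Ce : ℝ → ℝ, ∀ θ : ℝ, 0 < θ → θ < 1 → 0 < Ch θ ∧ 0 < Ce θ ∧
    ∀ Ω : Set Plane, IsOpen Ω → Bornology.IsBounded Ω →
    ∀ ν dt : ℝ, 0 < ν → 0 < dt → dt < dtLimit θ ν (stokesLambda Ω) →
    -- the number `ε`, the matrix `H = diag(h₁₁ I, h₂₂ I)`, and what characterizes them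
    ∃ ε a b c h₁₁ h₂₂ : ℝ, 0 < ε ∧
      (∀ x y z : L2 Ω,
        gNormSq θ x y - gNormSq θ y z
            + ‖dissip θ 2 • x + dissip θ 1 • y + dissip θ 0 • z‖ ^ 2
            + ν * dt * stokesLambda Ω / 2 * ‖beta θ 2 • x + beta θ 1 • y + beta θ 0 • z‖ ^ 2
          = (1 + ε) * hNormSq h₁₁ h₂₂ x y - hNormSq h₁₁ h₂₂ y z
            + ‖a • x + b • y + c • z‖ ^ 2) ∧
      hLower θ < h₁₁ ∧ 0 < hLower θ ∧
      1 / 16 * θ * (1 - θ) ^ 2 * (1 + θ) * (2 + θ) < h₂₂ ∧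
      0 < 1 / 16 * θ * (1 - θ) ^ 2 * (1 + θ) * (2 + θ) ∧
      max h₁₁ h₂₂ < Ch θ ∧ 1 / 4 < 1 / ε ∧ 1 / ε < Ce θ / (ν * stokesLambda Ω * dt) ∧
      -- the stability estimates
      ∀ (f : ℝ → L2 Ω) (u : ℕ → V Ω), IsForce f → IsDLNSolution θ ν dt f u →
        (∀ N : ℕ, 2 ≤ N →
          hNormSq h₁₁ h₂₂ (vel (u N)) (vel (u (N - 1)))
            ≤ 1 / (1 + ε) ^ (N - 1) * hNormSq h₁₁ h₂₂ (vel (u 1)) (vel (u 0))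
              + Ce θ / (2 * ν ^ 2 * stokesLambda Ω ^ 2) * forceNorm f ^ 2) ∧
        (∀ N : ℕ, 2 ≤ N →
          ‖vel (u N)‖ ≤
            K2 θ (Ch θ) (Ce θ) ν (stokesLambda Ω) ‖vel (u 0)‖ ‖vel (u 1)‖ (forceNorm f)) ∧
        (∀ N i : ℕ, 1 ≤ N → 1 ≤ i → i ≤ N - 1 →
          ν * dt * ∑ n ∈ Finset.Icc i (N - 1), ‖grad (comb (beta θ) u n)‖ ^ 2
            ≤ 2 * gNormSq θ (vel (u i)) (vel (u (i - 1)))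
              + ((N : ℝ) - i) * dt / (ν * stokesLambda Ω) * forceNorm f ^ 2) ∧
        (∀ N i : ℕ, 1 ≤ N → 1 ≤ i → i ≤ N - 1 →
          dt * (ν * (2 * beta θ 2 - 1) / 8)
              * ∑ j ∈ Finset.Icc i (N - 1), ‖grad (u (j + 1))‖ ^ 2
            + gNormSq θ (vel (u N)) (vel (u (N - 1)))
            + dt * ν * (1 / 4 * ‖grad (u N)‖ ^ 2
                + (beta θ 0 / 2 + (2 * beta θ 2 - 1) / 8) * ‖grad (u (N - 1))‖ ^ 2)
            + ∑ j ∈ Finset.Icc i (N - 1),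
                (θ / 2 * ‖vel (u (j + 1)) - vel (u j)‖ ^ 2
                  + 1 / 4 * (1 - θ) * ‖vel (u (j + 1)) - vel (u (j - 1))‖ ^ 2)
            + ν * dt * ∑ j ∈ Finset.Icc i (N - 1),
                (beta θ 1 / 2 * ‖grad (u (j + 1)) + grad (u j)‖ ^ 2
                  + beta θ 0 / 2 * ‖grad (u (j + 1)) + grad (u (j - 1))‖ ^ 2)
            ≤ (1 + K2 θ (Ch θ) (Ce θ) ν (stokesLambda Ω) ‖vel (u 0)‖ ‖vel (u 1)‖ (forceNorm f) ^ 4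
                    * (beta θ 0 ^ 2 + beta θ 1 ^ 2) ^ 2 / (ν ^ 4 * (2 * beta θ 2 - 1) ^ 3))
                * gNormSq θ (vel (u i)) (vel (u (i - 1)))
              + dt * ν * (1 / 4 * ‖grad (u i)‖ ^ 2
                  + (beta θ 0 / 2 + (2 * beta θ 2 - 1) / 8) * ‖grad (u (i - 1))‖ ^ 2)
              + ((N : ℝ) - i) * dt / (ν * (2 * beta θ 2 - 1) * stokesLambda Ω)
                * (2 + K2 θ (Ch θ) (Ce θ) ν (stokesLambda Ω) ‖vel (u 0)‖ ‖vel (u 1)‖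
                        (forceNorm f) ^ 4
                      * (beta θ 0 ^ 2 + beta θ 1 ^ 2) ^ 2 / (2 * ν ^ 4 * (2 * beta θ 2 - 1) ^ 2))
                * forceNorm f ^ 2) := by
  -- `h₁₁, h₂₂ < 2`, so `ε (h₁₁ + h₂₂) ≥ μ / 64` with `μ = ν Δt λ₁ / 2` gives
  -- `1 / ε < 256 / μ = 512 / (ν λ₁ Δt)`
  refine ⟨fun _ => 2, fun _ => 512, fun θ h0 h1 => ⟨two_pos, by norm_num, ?_⟩⟩
  intro Ω _ hΩ ν dt hν hdt hlim
  obtain ⟨hlam, hμ1, hμ2⟩ := step_bounds_of_lt_dtLimit h0 h1 hν hdt hlim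
  have hμ : 0 < ν * dt * stokesLambda Ω / 2 := by positivity
  obtain ⟨ε, a, b, c, h₁₁, h₂₂, hε, hε4, hεμ, h11l, h11u, h22l, h22u, hxx, hyy, hzz, hxy, hxz,
    hyz⟩ := exists_hNorm_coeffs h0 h1 hμ hμ1 hμ2
  have hid := gNormSq_sub_eq_hNormSq (Ω := Ω) h0 h1 hxx hyy hzz hxy hxz hyz
  have hθ : 0 < 1 - θ := sub_pos.2 h1
  have hL : 0 < hLower θ := by
    have : 0 < 1 - 1 / 2 * θ * (1 - θ) := by linarith [sq_nonneg (θ - 1 / 2)]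
    rw [hLower]
    positivity
  have h11p : 0 < h₁₁ := hL.trans h11l
  have h22p : 0 < h₂₂ := by linarith
  have hD := two_mul_beta_sub_one_pos h0 h1
  have hε1 : 1 / ε < 512 / (ν * stokesLambda Ω * dt) := by
    have : ε * (h₁₁ + h₂₂) < ε * 4 := by
      gcongr
      linarith
    rw [div_lt_div_iff₀ hε (by positivity)]
    linarith
  have h22l' : 1 / 16 * θ * (1 - θ) ^ 2 * (1 + θ) * (2 + θ) < h₂₂ := by
    refine lt_of_le_of_lt ?_ h22l
    have e : 1 / 16 * θ * (1 - θ) ^ 2 * (1 + θ) * (2 + θ)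
        = (1 - θ) * (1 / 16 * (θ * (1 - θ)) * ((1 + θ) * (2 + θ))) := by ring
    have k1 : θ * (1 - θ) ≤ 1 / 4 := by linarith [sq_nonneg (θ - 1 / 2)]
    have k2 : (1 + θ) * (2 + θ) ≤ 2 * 3 := by gcongr <;> linarith
    have k3 : 1 / 16 * (θ * (1 - θ)) * ((1 + θ) * (2 + θ)) ≤ 1 / 16 * (1 / 4) * (2 * 3) := by
      gcongr
    rw [e]
    linarith [mul_le_mul_of_nonneg_left k3 hθ.le]
  refine ⟨ε, a, b, c, h₁₁, h₂₂, hε, hid, h11l, hL, h22l', by positivity, max_lt h11u h22u,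
    one_div_lt_one_div_of_lt hε hε4, hε1, ?_⟩
  intro f u hf hu
  set F := forceNorm f with hF
  -- damping in the `H`-norm
  have hH : ∀ N : ℕ, 1 ≤ N → hNormSq h₁₁ h₂₂ (vel (u N)) (vel (u (N - 1)))
      ≤ 1 / (1 + ε) ^ (N - 1) * hNormSq h₁₁ h₂₂ (vel (u 1)) (vel (u 0))
        + 512 / (2 * ν ^ 2 * stokesLambda Ω ^ 2) * F ^ 2 := by
    intro N hN
    have k := le_of_damped_step (H := fun n => hNormSq h₁₁ h₂₂ (vel (u n)) (vel (u (n - 1))))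
      (κ := dt / (2 * (ν * stokesLambda Ω)) * F ^ 2) hε (by positivity)
      (fun n hn => energy_step_hNormSq hΩ h0 h1 hν hdt hlam hf hu hid hn) hN
    refine k.trans ?_
    have e : 512 / (2 * ν ^ 2 * stokesLambda Ω ^ 2) * F ^ 2
        = 512 / (ν * stokesLambda Ω * dt) * (dt / (2 * (ν * stokesLambda Ω)) * F ^ 2) := by
      field_simp
    rw [e]
    exact add_le_add le_rfl (mul_le_mul_of_nonneg_right hε1.le (by positivity))
  -- the uniform bound of the velocities
  have hK : ∀ n : ℕ, ‖vel (u n)‖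
      ≤ K2 θ 2 512 ν (stokesLambda Ω) ‖vel (u 0)‖ ‖vel (u 1)‖ F := by
    intro n
    refine Real.le_sqrt_of_sq_le ?_
    rw [le_div_iff₀ hL, K1]
    have hF0 : 0 ≤ 512 / (2 * ν ^ 2 * stokesLambda Ω ^ 2) * F ^ 2 := by positivity
    have hH1 : hNormSq h₁₁ h₂₂ (vel (u 1)) (vel (u 0))
        ≤ 2 * (‖vel (u 1)‖ ^ 2 + ‖vel (u 0)‖ ^ 2) := by
      rw [hNormSq, mul_add]
      gcongr
    have hlow : ‖vel (u n)‖ ^ 2 * hLower θ ≤ ‖vel (u n)‖ ^ 2 * h₁₁ := by gcongr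
    rcases Nat.eq_zero_or_pos n with rfl | hn
    · have : ‖vel (u 0)‖ ^ 2 * h₁₁ ≤ ‖vel (u 0)‖ ^ 2 * 2 := by gcongr
      have := sq_nonneg ‖vel (u 1)‖
      linarith
    · have k1 := hH n hn
      have k2 : 1 / (1 + ε) ^ (n - 1) * hNormSq h₁₁ h₂₂ (vel (u 1)) (vel (u 0))
          ≤ 1 * hNormSq h₁₁ h₂₂ (vel (u 1)) (vel (u 0)) := by
        have : 0 ≤ hNormSq h₁₁ h₂₂ (vel (u 1)) (vel (u 0)) := by
          rw [hNormSq]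
          positivity
        gcongr
        rw [div_le_one (by positivity)]
        exact one_le_pow₀ (by linarith)
      have k3 : ‖vel (u n)‖ ^ 2 * h₁₁ ≤ hNormSq h₁₁ h₂₂ (vel (u n)) (vel (u (n - 1))) := by
        rw [hNormSq]
        have : 0 ≤ h₂₂ * ‖vel (u (n - 1))‖ ^ 2 := by positivity
        linarith
      linarith
  have hgrad : ∀ N i : ℕ, 1 ≤ i → i ≤ N - 1 →
      ν * dt * ∑ n ∈ Finset.Icc i (N - 1), ‖grad (comb (beta θ) u n)‖ ^ 2
        ≤ 2 * gNormSq θ (vel (u i)) (vel (u (i - 1)))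
          + ((N : ℝ) - i) * dt / (ν * stokesLambda Ω) * F ^ 2 := by
    intro N i hi hiN
    have k := sum_Icc_add_le_of_step (N := N)
      (A := fun n => ν * dt * ‖grad (comb (beta θ) u n)‖ ^ 2)
      (S := fun n => 2 * gNormSq θ (vel (u n)) (vel (u (n - 1)))) hi (by omega)
      (fun n hn => energy_step_gradient hΩ h0 h1 hν hdt hlam hf hu (hi.trans hn))
    rw [← Finset.mul_sum] at k
    have := gNormSq_nonneg h0 h1 (vel (u N)) (vel (u (N - 1)))
    have e : ((N : ℝ) - i) * dt / (ν * stokesLambda Ω) * F ^ 2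
        = ((N : ℝ) - i) * (dt / (ν * stokesLambda Ω) * F ^ 2) := by ring
    rw [e]
    linarith
  refine ⟨fun N hN => hH N (by omega), fun N _ => hK N, fun N i _ hi hiN => hgrad N i hi hiN, ?_⟩
  intro N i _ hi hiN
  have k3 := hgrad N i hi hiN
  generalize K2 θ 2 512 ν (stokesLambda Ω) ‖vel (u 0)‖ ‖vel (u 1)‖ F = K at hK ⊢
  obtain ⟨M, hM⟩ : ∃ M, M = K ^ 4 * (beta θ 0 ^ 2 + beta θ 1 ^ 2) ^ 2
      / (2 * ν ^ 3 * (2 * beta θ 2 - 1) ^ 3) := ⟨_, rfl⟩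
  have hM0 : 0 ≤ M := by rw [hM]; positivity
  have k4 := sum_Icc_add_le_of_step (N := N)
    (A := fun n => dt * (ν * (2 * beta θ 2 - 1) / 8) * ‖grad (u (n + 1))‖ ^ 2
        + (θ / 2 * ‖vel (u (n + 1)) - vel (u n)‖ ^ 2
          + 1 / 4 * (1 - θ) * ‖vel (u (n + 1)) - vel (u (n - 1))‖ ^ 2)
        + ν * dt * (beta θ 1 / 2 * ‖grad (u (n + 1)) + grad (u n)‖ ^ 2
          + beta θ 0 / 2 * ‖grad (u (n + 1)) + grad (u (n - 1))‖ ^ 2)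
        - dt * M * ‖grad (comb (beta θ) u n)‖ ^ 2)
    (S := fun n => gNormSq θ (vel (u n)) (vel (u (n - 1)))
          + dt * ν * (1 / 4 * ‖grad (u n)‖ ^ 2
            + (beta θ 0 / 2 + (2 * beta θ 2 - 1) / 8) * ‖grad (u (n - 1))‖ ^ 2))
    (c := dt * (2 / (ν * (2 * beta θ 2 - 1) * stokesLambda Ω) * F ^ 2)) hi (by omega)
    (fun n hn => by
      have k := gradient_step hΩ h0 h1 hν hdt hlam hf hu hK (hi.trans hn)
      rw [← hM] at k
      simp only [Nat.add_sub_cancel]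
      linarith)
  simp only [Finset.sum_sub_distrib, Finset.sum_add_distrib, ← Finset.mul_sum] at k4
  -- the sum of the convection terms is bounded by the preceding estimate
  have k5 := mul_le_mul_of_nonneg_left k3 (div_nonneg hM0 hν.le)
  have e1 : M / ν * (ν * dt * ∑ n ∈ Finset.Icc i (N - 1), ‖grad (comb (beta θ) u n)‖ ^ 2)
      = dt * M * ∑ n ∈ Finset.Icc i (N - 1), ‖grad (comb (beta θ) u n)‖ ^ 2 := by
    field_simp
  have e2 : (1 + K ^ 4 * (beta θ 0 ^ 2 + beta θ 1 ^ 2) ^ 2 / (ν ^ 4 * (2 * beta θ 2 - 1) ^ 3))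
      = 1 + M / ν * 2 := by
    rw [hM]
    field_simp
  have e3 : ((N : ℝ) - i) * dt / (ν * (2 * beta θ 2 - 1) * stokesLambda Ω)
        * (2 + K ^ 4 * (beta θ 0 ^ 2 + beta θ 1 ^ 2) ^ 2
          / (2 * ν ^ 4 * (2 * beta θ 2 - 1) ^ 2)) * F ^ 2
      = ((N : ℝ) - i) * (dt * (2 / (ν * (2 * beta θ 2 - 1) * stokesLambda Ω) * F ^ 2))
        + M / ν * (((N : ℝ) - i) * dt / (ν * stokesLambda Ω) * F ^ 2) := by
    rw [hM]
    field_simp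
  rw [e1] at k5
  rw [e2, e3]
  simp only [Finset.sum_add_distrib, ← Finset.mul_sum]
  linarith
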